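/- Let $m,n\ge 1$ be integers, let $Q\subset\mathbb R^m$ be a convex body with the origin in its interior, with support function $h_Q(u)=\sup_{y\in Q}\langle y,u\rangle$, let $\Omega\subset\mathbb R^n$ be a bounded open set, and let $1\le p<\infty$. For $p>1$ let $X_p(\Omega)=W^{1,p}_0(\Omega)$, the completion of $C_0^\infty(\Omega)$ in the norm $\||\nabla f|\|_{L^p}$, its elements being extended by $0$ to $\mathbb R^n$. For $p=1$ let $X_1(\Omega)$ be the set of all $f\in BV(\mathbb R^n)$ that vanish a.e. outside $\Omega$, and in this case read $\int F(\nabla f)\,dx$, for a $1$-homogeneous function $F$, as $\int_{\mathbb R^n}F(\eta_f)\,d|Df|$, where $|Df|$ is the variation measure of $Df$ and $\eta_f=\frac{dDf}{d|Df|}$; in particular $\||\nabla f|\|_{L^1}=|Df|(\mathbb R^n)$. Identify $\mathbb R^{nm}$ with the real $n\times m$ matrices, write $d\theta$, $dv$ for spherical Lebesgue measure (counting measure on $\mathbb S^0$), and let $\omega_n$ be the volume of the unit ball $B_2^n$. Define $$\mathcal E_{Q,p}f=d_{n,p}(Q)\Big(\int_{\mathbb S^{nm-1}}\|h_Q(\theta^t\nabla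 f(\cdot))\|_{L^p(\mathbb R^n)}^{-nm}\,d\theta\Big)^{-\frac1{nm}},\qquad d_{n,p}(Q)=(n\omega_n)^{\frac1p}\big(nm\operatorname{vol}_{nm}(\Pi^\circ_{Q,p}B_2^n)\big)^{\frac1{nm}},$$ where $\Pi^\circ_{Q,p}B_2^n\subset\mathbb R^{nm}$ is the convex body with gauge $u\mapsto\big(\int_{\mathbb S^{n-1}}h_Q(u^tv)^p\,dv\big)^{1/p}$. For $1\le q\le p$ put $$\lambda_{1,p}(\Omega)=\inf_f\frac{\||\nabla f|\|_{L^p}^p}{\|f\|_{L^p(\Omega)}^p},\quad \lambda^{\mathcal A}_{1,p}(Q,\Omega)=\inf_f\frac{(\mathcal E_{Q,p}f)^p}{\|f\|_{L^p(\Omega)}^p},\quad \lambda^{q}_{1,p}(\Omega)=\inf_f\frac{\||\nabla f|\|_{L^p}}{\|f\|_{L^q(\Omega)}},\quad \lambda^{\mathcal A,q}_{1,p}(Q,\Omega)=\inf_f\frac{\mathcal E_{Q,p}f}{\|f\|_{L^q(\Omega)}},$$ all infima being over $f\in X_p(\Omega)\setminus\{0\}$ (with $\inf\emptyset=+\infty$).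 Then there is a constant $d=d(Q,p,\Omega)>0$ such that $$\lambda_{1,p}(\Omega)\ \ge\ \lambda^{\mathcal A}_{1,p}(Q,\Omega)\ \ge\ d\,\lambda_{1,p}(\Omega)^{\frac1{nm}}.$$ More generally, for every $1\le q\le p$ there is a constant $d_0=d_0(Q,p,q,\Omega)>0$ such that $$\lambda^q_{1,p}(\Omega)\ \ge\ \lambda^{\mathcal A,q}_{1,p}(Q,\Omega)\ \ge\ d_0\,\lambda^q_{1,p}(\Omega)^{\frac1{nm}}.$$ -/

import Mathlib

open MeasureTheory Filter Topology
open scoped ENNReal NNReal ContDiff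

noncomputable section

namespace AffineEigenvalue

/-- Euclidean space `ℝⁿ`. -/
abbrev Euc (n : ℕ) : Type := EuclideanSpace ℝ (Fin n)

/-- `ℝ^{nm} = (ℝⁿ)^m`, viewed as the space of real `n × m` matrices with the Euclidean norm. -/
abbrev Mat (n m : ℕ) : Type := EuclideanSpace ℝ (Fin n × Fin m)

/-- The support function `h_Q(u) = sup_{y ∈ Q} ⟨y, u⟩` of a convex body `Q ⊂ ℝᵐ`. -/
def supportFun {m : ℕ} (Q : ConvexBody (Euc m)) (u : Euc m) : ℝ :=
  sSup ((fun y : Euc m => inner ℝ y u) '' (Q : Set (Euc m)))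

/-- The product `θᵗ v ∈ ℝᵐ` of the transpose of the `n × m` matrix `θ` with `v ∈ ℝⁿ`. -/
def transposeMul {n m : ℕ} (θ : Mat n m) (v : Euc n) : Euc m :=
  WithLp.toLp 2 (fun j : Fin m => ∑ i : Fin n, θ (i, j) * v i)

/-- The `(L^p, Q)`-polar projection body of the Euclidean unit ball of `ℝⁿ`: the subset of
`ℝ^{nm}` with gauge `u ↦ (∫_{S^{n-1}} h_Q(uᵗ v)^p dσ(v))^{1/p}`. The `L^p` surface area measure of
the unit ball is the spherical Lebesgue measure `dσ`, because the support function of the ball is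
constantly `1` on the sphere. -/
def polarProjectionBall {m : ℕ} (n : ℕ) (Q : ConvexBody (Euc m)) (p : ℝ) : Set (Mat n m) :=
  {u | eLpNorm (fun v : Metric.sphere (0 : Euc n) 1 => supportFun Q (transposeMul u (v : Euc n)))
      (ENNReal.ofReal p) (volume : Measure (Euc n)).toSphere ≤ 1}

/-- The normalizing constant
`d_{n,p}(Q) = (n ω_n)^{1/p} (n m vol_{nm}(Π°_{Q,p} B_2^n))^{1/(nm)}`. -/
def normConst {m : ℕ} (n : ℕ) (Q : ConvexBody (Euc m)) (p : ℝ) : ℝ≥0∞ :=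
  ((n : ℝ≥0∞) * volume (Metric.closedBall (0 : Euc n) 1)) ^ (1 / p) *
    ((n : ℝ≥0∞) * (m : ℝ≥0∞) * volume (polarProjectionBall n Q p)) ^ (1 / ((n : ℝ) * (m : ℝ)))

/-- The `m`th-order affine energy of a gradient. The gradient of `f` is given by a measure `μ` and
a vector field `G`: for a Sobolev function, `μ` is Lebesgue measure and `G = ∇f`; for a function
of bounded variation (and `p = 1`), `μ = |Df|` and `G = η_f = dDf / d|Df|`. The value is
`d_{n,p}(Q) (∫_{S^{nm-1}} ‖h_Q(θᵗ G)‖_{L^p(μ)}^{-nm} dθ)^{-1/(nm)}`. -/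
def affineEnergy {n m : ℕ} (Q : ConvexBody (Euc m)) (p : ℝ) (μ : Measure (Euc n))
    (G : Euc n → Euc n) : ℝ≥0∞ :=
  normConst n Q p *
    (∫⁻ θ : Metric.sphere (0 : Mat n m) 1,
      (eLpNorm (fun x => supportFun Q (transposeMul (θ : Mat n m) (G x)))
        (ENNReal.ofReal p) μ) ^ (-((n : ℝ) * (m : ℝ)))
      ∂(volume : Measure (Mat n m)).toSphere) ^ (-(1 / ((n : ℝ) * (m : ℝ))))

/-- `f ∈ W_0^{1,p}(Ω)` with gradient `G`, for bounded open `Ω`; both are functions on `ℝⁿ`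
(extension by zero). `W_0^{1,p}(Ω)` is the completion of `C_0^∞(Ω)` in the norm `‖|∇f|‖_{L^p}`;
as this norm controls the `L^p` norm on `C_0^∞(Ω)`, the elements of the completion are the limits
`f` in `L^p` of test functions whose gradients converge in `L^p`, and `G` is the limit of the
gradients. It is determined by `f` up to a null set. -/
def IsSobolevZero {n : ℕ} (p : ℝ) (Ω : Set (Euc n)) (f : Euc n → ℝ) (G : Euc n → Euc n) : Prop :=
  MemLp f (ENNReal.ofReal p) volume ∧ MemLp G (ENNReal.ofReal p) volume ∧
    ∃ φ : ℕ → Euc n → ℝ,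
      (∀ k, ContDiff ℝ ∞ (φ k) ∧ HasCompactSupport (φ k) ∧ tsupport (φ k) ⊆ Ω) ∧
      Tendsto (fun k => eLpNorm (fun x => φ k x - f x) (ENNReal.ofReal p) volume) atTop (𝓝 0) ∧
      Tendsto (fun k => eLpNorm (fun x => gradient (φ k) x - G x) (ENNReal.ofReal p) volume)
        atTop (𝓝 0)

/-- `f` is (the extension by zero of) a function on `Ω` that is of bounded variation in `ℝⁿ`. Its
distributional derivative is the finite `ℝⁿ`-valued measure `Df = η μ` with `|η| = 1` `μ`-almost
everywhere. So `μ` is the variation measure `|Df|` and `η` is the Radon-Nikodym derivative `η_f` of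
`Df` with respect to `|Df|`. Both are determined by `f` (`η` up to a `|Df|`-null set). -/
def IsBVZero {n : ℕ} (Ω : Set (Euc n)) (f : Euc n → ℝ) (μ : Measure (Euc n))
    (η : Euc n → Euc n) : Prop :=
  Integrable f volume ∧ (∀ᵐ x ∂(volume : Measure (Euc n)), x ∉ Ω → f x = 0) ∧
    IsFiniteMeasure μ ∧ Measurable η ∧ (∀ᵐ x ∂μ, ‖η x‖ = 1) ∧
    ∀ φ : Euc n → ℝ, ContDiff ℝ ∞ φ → HasCompactSupport φ → ∀ v : Euc n,
      ∫ x, f x * fderiv ℝ φ x v = -∫ x, φ x * inner ℝ (η x) v ∂μ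

/-- The competitors in the variational problems, together with their gradient `(μ, G)`: nonzero
elements of `W_0^{1,p}(Ω)` if `p ≠ 1`, and nonzero functions of bounded variation if `p = 1`. -/
def IsCompetitor {n : ℕ} (p : ℝ) (Ω : Set (Euc n)) (f : Euc n → ℝ) (μ : Measure (Euc n))
    (G : Euc n → Euc n) : Prop :=
  (p ≠ 1 → μ = volume ∧ IsSobolevZero p Ω f G) ∧ (p = 1 → IsBVZero Ω f μ G) ∧
    ¬ f =ᵐ[volume] 0

/-- `λ_{1,p}(Ω)`, the infimum of the Rayleigh quotients `∫ |∇f|^p / ∫_Ω |f|^p`. -/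
def lam {n : ℕ} (p : ℝ) (Ω : Set (Euc n)) : ℝ≥0∞ :=
  sInf {r | ∃ f μ G, IsCompetitor p Ω f μ G ∧
    r = (∫⁻ x, ‖G x‖ₑ ^ p ∂μ) / (∫⁻ x in Ω, ‖f x‖ₑ ^ p)}

/-- `λ^𝒜_{1,p}(Q, Ω)`, the infimum of the affine Rayleigh quotients
`(ℰ_{Q,p} f)^p / ‖f‖_{L^p(Ω)}^p`. -/
def lamAff {n m : ℕ} (Q : ConvexBody (Euc m)) (p : ℝ) (Ω : Set (Euc n)) : ℝ≥0∞ :=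
  sInf {r | ∃ f μ G, IsCompetitor p Ω f μ G ∧
    r = (affineEnergy Q p μ G) ^ p / (eLpNorm f (ENNReal.ofReal p) (volume.restrict Ω)) ^ p}

/-- `λ^q_{1,p}(Ω)`, the infimum of `‖|∇f|‖_{L^p} / ‖f‖_{L^q(Ω)}`. -/
def lamQ {n : ℕ} (p q : ℝ) (Ω : Set (Euc n)) : ℝ≥0∞ :=
  sInf {r | ∃ f μ G, IsCompetitor p Ω f μ G ∧
    r = eLpNorm G (ENNReal.ofReal p) μ / eLpNorm f (ENNReal.ofReal q) (volume.restrict Ω)}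

/-- `λ^{𝒜,q}_{1,p}(Q, Ω)`, the infimum of `ℰ_{Q,p} f / ‖f‖_{L^q(Ω)}`. -/
def lamAffQ {n m : ℕ} (Q : ConvexBody (Euc m)) (p q : ℝ) (Ω : Set (Euc n)) : ℝ≥0∞ :=
  sInf {r | ∃ f μ G, IsCompetitor p Ω f μ G ∧
    r = affineEnergy Q p μ G / eLpNorm f (ENNReal.ofReal q) (volume.restrict Ω)}

end AffineEigenvalue

end

/-! Write `N = nm`, `g(θ) = ‖h_Q(θᵗ∇f)‖_{L^p}`, `D = ‖∇f‖_{L^p}` and `P = ‖f‖_{L^p}`. Both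
inequalities are proved for each competitor and then passed to the infima.

Upper bound, `ℰf ≤ D` (`affineEnergy_le`). Let `b` be the gauge of the polar projection body of the
ball, `M` the total mass of the unit sphere of `ℝⁿ` and `s = N/p`. Since `b` is invariant under
rotations of the columns, the average of `g^p` against the weight `(b^p)^(-s-1)` depends on `∇f`
only through `D`. Taking the identity field on the sphere in place of `∇f` identifies the constant.
Integrating the tangent line inequality for the convex function `x ↦ x^(-s)` at `t b^p`, with `t =
D^p / M`, gives `∫ g^(-N) ≥ t^(-s) ∫ b^(-N)`, which is the claim after normalization
(`rpow_mul_ballIntegral_le`).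

Lower bound, `ℰf ≥ c D^(1/N) P^(1-1/N)` (`le_affineEnergy`). In polar coordinates `∫ g^(-N)` is `N`
times the volume of `{g ≤ 1}` (`lintegral_sphere_rpow_neg`). As `Q` contains a ball, the columns `w`
of a matrix in this body satisfy `‖⟨w, ∇f⟩‖_p ≤ 1/r`. A Poincaré inequality in every direction then
puts the body in a box of side of order `1/P`. Some coordinate derivative has norm at least `D/n`,
so the body has length of order at most `1/D` in one coordinate direction. Hence its volume is at
most a constant times `D⁻¹ P^(1-N)` (`volume_gradGauge_le`). Since `Ω` is bounded, `‖f‖_q ≤ C P`,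
and dividing by `‖f‖_q` gives the power `1/N` of the Rayleigh quotient.

The directional Poincaré inequality comes from integrating along segments that leave `Ω`: directly
for test functions, followed by a limit, and by duality for functions of bounded variation. -/

noncomputable section

namespace AffineEigenvalue

/-! ### Support functions of convex bodies -/

section Support

open scoped Pointwise

variable {m : ℕ} (Q : ConvexBody (Euc m))

theorem bddAbove_support (u : Euc m) :
    BddAbove ((fun y : Euc m => inner ℝ y u) '' (Q : Set (Euc m))) :=
  (Q.isCompact.image (by fun_prop)).bddAbove

theorem inner_le_supportFun {y : Euc m} (hy : y ∈ (Q : Set (Euc m))) (u : Euc m) :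
    inner ℝ y u ≤ supportFun Q u :=
  le_csSup (bddAbove_support Q u) ⟨y, hy, rfl⟩

theorem supportFun_le {u : Euc m} {c : ℝ} (h : ∀ y ∈ (Q : Set (Euc m)), inner ℝ y u ≤ c) :
    supportFun Q u ≤ c :=
  csSup_le (Q.nonempty.image _) (by rintro _ ⟨y, hy, rfl⟩; exact h y hy)

theorem exists_supportFun_le :
    ∃ R : ℝ, 0 < R ∧ ∀ u, supportFun Q u ≤ R * ‖u‖ := by
  obtain ⟨R, hR, h⟩ := Q.isCompact.isBounded.exists_pos_norm_le
  refine ⟨R, hR, fun u => supportFun_le Q fun y hy => ?_⟩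
  exact (real_inner_le_norm y u).trans (by gcongr; exact h y hy)

theorem exists_le_supportFun (hQ : (0 : Euc m) ∈ interior (Q : Set (Euc m))) :
    ∃ r : ℝ, 0 < r ∧ ∀ u, r * ‖u‖ ≤ supportFun Q u := by
  obtain ⟨r, hr, h⟩ := Metric.isOpen_iff.1 isOpen_interior 0 hQ
  refine ⟨r / 2, by positivity, fun u => ?_⟩
  rcases eq_or_ne u 0 with rfl | hu
  · simpa using inner_le_supportFun Q (interior_subset hQ) 0
  · have hu' : ‖u‖ ≠ 0 := norm_ne_zero_iff.2 hu
    have hm : ((r / 2) / ‖u‖) • u ∈ (Q : Set (Euc m)) := by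
      refine interior_subset (h ?_)
      rw [mem_ball_zero_iff, norm_smul, norm_div, norm_norm, div_mul_cancel₀ _ hu',
        Real.norm_of_nonneg (by positivity)]
      linarith
    refine le_trans (le_of_eq ?_) (inner_le_supportFun Q hm u)
    rw [real_inner_smul_left, real_inner_self_eq_norm_sq]
    field_simp

theorem supportFun_smul {t : ℝ} (ht : 0 ≤ t) (u : Euc m) :
    supportFun Q (t • u) = t * supportFun Q u := by
  unfold supportFun
  have : ((fun y : Euc m => inner ℝ y (t • u)) '' (Q : Set (Euc m))) =
      t • ((fun y : Euc m => inner ℝ y u) '' (Q : Set (Euc m))) := by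
    rw [← Set.image_smul, Set.image_image]
    simp [real_inner_smul_right]
  rw [this, Real.sSup_smul_of_nonneg ht, smul_eq_mul]

theorem supportFun_add_le (u v : Euc m) :
    supportFun Q (u + v) ≤ supportFun Q u + supportFun Q v :=
  supportFun_le Q fun y hy => by
    rw [inner_add_right]
    exact add_le_add (inner_le_supportFun Q hy u) (inner_le_supportFun Q hy v)

theorem continuous_supportFun : Continuous (supportFun Q) := by
  obtain ⟨R, hR, h⟩ := exists_supportFun_le Q
  have key : ∀ x y, supportFun Q x ≤ supportFun Q y + R * dist x y := fun x y => by
    have := supportFun_add_le Q y (x - y)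
    rw [add_sub_cancel] at this
    rw [dist_eq_norm]
    linarith [h (x - y)]
  exact (LipschitzWith.of_le_add_mul ⟨R, hR.le⟩ key).continuous

end Support

/-! ### Matrices, their columns and the product `θᵗ v` -/

section Matrix

variable {n m : ℕ}

/-- The `j`-th column of a matrix. -/
def col (u : Mat n m) (j : Fin m) : Euc n := WithLp.toLp 2 fun i => u (i, j)

theorem transposeMul_apply (u : Mat n m) (v : Euc n) (j : Fin m) :
    transposeMul u v j = inner ℝ (col u j) v := by
  simp [transposeMul, col, PiLp.inner_apply, mul_comm]

theorem col_smul (t : ℝ) (u : Mat n m) (j : Fin m) : col (t • u) j = t • col u j := by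
  ext i; simp [col]

theorem col_add (u v : Mat n m) (j : Fin m) : col (u + v) j = col u j + col v j := by
  ext i; simp [col]

theorem transposeMul_smul_left (t : ℝ) (u : Mat n m) (v : Euc n) :
    transposeMul (t • u) v = t • transposeMul u v := by
  ext j; simp [transposeMul_apply, col_smul, real_inner_smul_left]

theorem transposeMul_smul_right (t : ℝ) (u : Mat n m) (v : Euc n) :
    transposeMul u (t • v) = t • transposeMul u v := by
  ext j; simp [transposeMul_apply, real_inner_smul_right]

theorem norm_sq_eq_sum_col (u : Mat n m) : ‖u‖ ^ 2 = ∑ j, ‖col u j‖ ^ 2 := by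
  simp only [EuclideanSpace.norm_sq_eq]
  rw [Fintype.sum_prod_type_right]
  rfl

theorem norm_transposeMul_le (u : Mat n m) (v : Euc n) : ‖transposeMul u v‖ ≤ ‖u‖ * ‖v‖ := by
  refine le_of_sq_le_sq ?_ (by positivity)
  rw [EuclideanSpace.norm_sq_eq, mul_pow, norm_sq_eq_sum_col, Finset.sum_mul]
  gcongr with j
  rw [transposeMul_apply, ← mul_pow]
  gcongr
  exact norm_inner_le_norm _ _

theorem abs_inner_col_le (u : Mat n m) (v : Euc n) (j : Fin m) :
    |inner ℝ (col u j) v| ≤ ‖transposeMul u v‖ := by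
  rw [← transposeMul_apply]
  exact PiLp.norm_apply_le (transposeMul u v) j

theorem continuous_transposeMul :
    Continuous fun x : Mat n m × Euc n => transposeMul x.1 x.2 := by
  unfold transposeMul
  fun_prop

end Matrix

/-! ### Volume of a star body in polar coordinates -/

section Polar

open Measure Set

/-- Radial part of the polar coordinate formula: the measure has density `r^k` and the set is `(0,
1/g]`. For `g = 0` it is the whole half-line and both sides are `⊤`; for `g = ⊤` it is empty and
both sides vanish. -/
theorem volumeIoiPow_smul_le_one (k : ℕ) (g : ℝ≥0∞) :
    volumeIoiPow k {r : Ioi (0 : ℝ) | ENNReal.ofReal r * g ≤ 1} =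
      g ^ (-((k : ℝ) + 1)) / (k + 1) := by
  have hk : (0 : ℝ) < k + 1 := by positivity
  have hk' : ((k : ℝ≥0∞) + 1) ≠ 0 := by simp
  have hk'' : ((k : ℝ≥0∞) + 1) ≠ ⊤ := by simp
  rcases eq_or_ne g 0 with rfl | h0
  · simp only [mul_zero, zero_le, ofPred_true]
    rw [ENNReal.zero_rpow_of_neg (by linarith), ENNReal.top_div_of_ne_top hk'', eq_top_iff]
    refine ENNReal.le_of_forall_nnreal_lt fun c _ => ?_
    -- For `x ≥ 1` the interval `(0, x)` has measure `x^(k+1)/(k+1) ≥ x/(k+1)`, so this endpoint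
    -- gives mass at least `c`.
    have hx : (0 : ℝ) < max 1 (c * (k + 1)) := lt_max_of_lt_left one_pos
    refine le_trans ?_ (measure_mono (subset_univ (Iio (⟨_, hx⟩ : Ioi (0 : ℝ)))))
    rw [volumeIoiPow_apply_Iio, ← ENNReal.ofReal_coe_nnreal]
    apply ENNReal.ofReal_le_ofReal
    rw [le_div_iff₀ hk]
    refine (le_max_right _ _).trans (le_self_pow₀ (le_max_left _ _) (by simp))
  rcases eq_or_ne g ⊤ with rfl | hT
  · have : {r : Ioi (0 : ℝ) | ENNReal.ofReal r * ⊤ ≤ 1} = ∅ := by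
      ext r
      have : ENNReal.ofReal r ≠ 0 := (ENNReal.ofReal_pos.2 r.2).ne'
      simp [ENNReal.mul_top this]
    rw [this, ENNReal.top_rpow_of_neg (by linarith)]
    simp
  · have hg : 0 < g.toReal := ENNReal.toReal_pos h0 hT
    have hgi : 0 < g.toReal⁻¹ := by positivity
    have hset : {r : Ioi (0 : ℝ) | ENNReal.ofReal r * g ≤ 1} = Iic ⟨g.toReal⁻¹, hgi⟩ := by
      ext r
      have hr : 0 < (r : ℝ) := r.2
      simp only [mem_ofPred_eq, mem_Iic]
      rw [← Subtype.coe_le_coe, le_inv_comm₀ hr hg, ← one_div, le_div_iff₀ hr, mul_comm,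
        ← ENNReal.ofReal_le_one, ENNReal.ofReal_mul ENNReal.toReal_nonneg,
        ENNReal.ofReal_toReal hT]
    have : NullSingletonClass (volumeIoiPow k) := by
      refine ⟨fun x => ?_⟩
      apply withDensity_absolutelyContinuous
      rw [comap_subtype_coe_apply measurableSet_Ioi]
      simp
    rw [hset, ← Iio_insert, measure_congr (insert_ae_eq_self _ _), volumeIoiPow_apply_Iio]
    rw [ENNReal.ofReal_div_of_pos hk, ENNReal.ofReal_add (by positivity) (by positivity)]
    simp only [ENNReal.ofReal_natCast, ENNReal.ofReal_one]
    congr 1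
    rw [ENNReal.rpow_neg, ← ENNReal.inv_rpow, inv_pow, ENNReal.ofReal_inv_of_pos (by positivity),
      ENNReal.ofReal_pow hg.le, ENNReal.ofReal_toReal hT, ENNReal.inv_rpow,
      ← ENNReal.rpow_natCast]
    simp

/-- Turns the integrals in the energy and in its normalizing constant into volumes. Values `0` and
`⊤` of `g` are allowed, so no nondegeneracy of the gradient is needed. -/
theorem lintegral_sphere_rpow_neg {E : Type*} [NormedAddCommGroup E] [NormedSpace ℝ E]
    [MeasurableSpace E] [BorelSpace E] [FiniteDimensional ℝ E] [Nontrivial E] (μ : Measure E)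
    [μ.IsAddHaarMeasure] {g : E → ℝ≥0∞} (hg : Measurable g)
    (hom : ∀ (t : ℝ) (x : E), 0 < t → g (t • x) = ENNReal.ofReal t * g x) :
    ∫⁻ θ : Metric.sphere (0 : E) 1, g θ ^ (-(Module.finrank ℝ E : ℝ)) ∂μ.toSphere =
      Module.finrank ℝ E * μ {x | g x ≤ 1} := by
  obtain ⟨k, hk⟩ : ∃ k, Module.finrank ℝ E = k + 1 :=
    Nat.exists_eq_add_one.2 Module.finrank_pos
  have hS : MeasurableSet {x | g x ≤ 1} := measurableSet_le hg measurable_const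
  have h1 : μ {x | g x ≤ 1} = (μ.comap ((↑) : ({0}ᶜ : Set E) → E))
      ((homeomorphUnitSphereProd E) ⁻¹' {q | ENNReal.ofReal q.2 * g q.1 ≤ 1}) := by
    rw [comap_subtype_coe_apply (measurableSet_singleton _).compl]
    have : ((↑) : ({0}ᶜ : Set E) → E) ''
        ((homeomorphUnitSphereProd E) ⁻¹' {q | ENNReal.ofReal q.2 * g q.1 ≤ 1}) =
        {x | g x ≤ 1} ∩ {0}ᶜ := by
      ext x
      simp only [mem_image, mem_preimage, mem_ofPred_eq, mem_inter_iff]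
      constructor
      · rintro ⟨y, hy, rfl⟩
        refine ⟨?_, y.2⟩
        rw [← hom _ _ (homeomorphUnitSphereProd E y).2.2] at hy
        have := congrArg Subtype.val ((homeomorphUnitSphereProd E).symm_apply_apply y)
        rw [homeomorphUnitSphereProd_symm_apply_coe] at this
        rwa [this] at hy
      · rintro ⟨hx, hx0⟩
        refine ⟨⟨x, hx0⟩, ?_, rfl⟩
        rw [← hom _ _ (homeomorphUnitSphereProd E ⟨x, hx0⟩).2.2]
        have := congrArg Subtype.val ((homeomorphUnitSphereProd E).symm_apply_apply ⟨x, hx0⟩)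
        rw [homeomorphUnitSphereProd_symm_apply_coe] at this
        rwa [this]
    rw [this, ← sdiff_eq, measure_sdiff_null (measure_singleton _)]
  have hm : MeasurableSet {q : Metric.sphere (0 : E) 1 × Ioi (0 : ℝ) |
      ENNReal.ofReal q.2 * g q.1 ≤ 1} := by
    refine measurableSet_le ?_ measurable_const
    fun_prop
  rw [h1, (measurePreserving_homeomorphUnitSphereProd μ).measure_preimage hm.nullMeasurableSet,
    prod_apply hm, ← lintegral_const_mul' _ _ (by simp)]
  refine lintegral_congr fun θ => ?_
  have := volumeIoiPow_smul_le_one (Module.finrank ℝ E - 1) (g θ)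
  simp only [preimage_ofPred_eq]
  rw [this, hk]
  simp only [Nat.add_sub_cancel, Nat.cast_add, Nat.cast_one]
  rw [ENNReal.mul_div_cancel (by simp) (by simp)]

end Polar

/-! ### The gauge `u ↦ ‖h_Q(uᵗ G)‖_{L^p(μ)}` -/

section Gauge

variable {n m : ℕ} {X : Type*} [MeasurableSpace X] {μ : Measure X} {G : X → Euc n}

/-- The function `u ↦ ‖h_Q(uᵗ G)‖_{L^p(μ)}` on matrices. -/
def gradGauge (Q : ConvexBody (Euc m)) (p : ℝ) (μ : Measure X) (G : X → Euc n) (u : Mat n m) :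
    ℝ≥0∞ :=
  eLpNorm (fun x => supportFun Q (transposeMul u (G x))) (ENNReal.ofReal p) μ

/-- The function `h_Q^p`. -/
def supportPow (Q : ConvexBody (Euc m)) (p : ℝ) (y : Euc m) : ℝ≥0∞ := ‖supportFun Q y‖ₑ ^ p

theorem measurable_supportPow (Q : ConvexBody (Euc m)) (p : ℝ) :
    Measurable (supportPow Q p) :=
  (continuous_supportFun Q).measurable.enorm.pow_const p

theorem supportPow_smul (Q : ConvexBody (Euc m)) {p : ℝ} (hp : 0 ≤ p) {t : ℝ} (ht : 0 ≤ t)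
    (y : Euc m) : supportPow Q p (t • y) = ENNReal.ofReal t ^ p * supportPow Q p y := by
  rw [supportPow, supportFun_smul Q ht, enorm_mul, ENNReal.mul_rpow_of_nonneg _ _ hp,
    Real.enorm_of_nonneg ht, supportPow]

theorem eLpNorm_ofReal_rpow {F : Type*} [NormedAddCommGroup F] {p : ℝ} (hp : 1 ≤ p) (f : X → F) :
    eLpNorm f (ENNReal.ofReal p) μ ^ p = ∫⁻ x, ‖f x‖ₑ ^ p ∂μ := by
  have hp0 : 0 < p := by linarith
  rw [eLpNorm_eq_lintegral_rpow_enorm_toReal (by simpa using hp0) (by simp),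
    ENNReal.toReal_ofReal hp0.le, ← ENNReal.rpow_mul, one_div, inv_mul_cancel₀ hp0.ne',
    ENNReal.rpow_one]

theorem gradGauge_rpow (Q : ConvexBody (Euc m)) {p : ℝ} (hp : 1 ≤ p) (u : Mat n m) :
    gradGauge Q p μ G u ^ p = ∫⁻ x, supportPow Q p (transposeMul u (G x)) ∂μ :=
  eLpNorm_ofReal_rpow hp _

theorem gradGauge_congr (Q : ConvexBody (Euc m)) (p : ℝ) {G' : X → Euc n} (h : G =ᵐ[μ] G') :
    gradGauge Q p μ G = gradGauge Q p μ G' := by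
  ext u
  refine eLpNorm_congr_ae ?_
  filter_upwards [h] with x hx
  rw [hx]

theorem measurable_supportPow_transposeMul (Q : ConvexBody (Euc m)) (p : ℝ) (hG : Measurable G) :
    Measurable fun z : Mat n m × X => supportPow Q p (transposeMul z.1 (G z.2)) :=
  (measurable_supportPow Q p).comp
    (continuous_transposeMul.measurable.comp (measurable_fst.prodMk (hG.comp measurable_snd)))

/-- Changing `G` on a null set does not affect the gauge, so a measurable version may be used;
measurability in `u` then follows from Tonelli. -/
theorem measurable_gradGauge [SFinite μ] (Q : ConvexBody (Euc m)) {p : ℝ} (hp : 1 ≤ p)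
    (hG : AEStronglyMeasurable G μ) : Measurable (gradGauge (m := m) Q p μ G) := by
  rw [gradGauge_congr Q p hG.ae_eq_mk]
  have hp0 : p ≠ 0 := by linarith
  have : gradGauge (m := m) Q p μ (hG.mk G) = fun u =>
      (∫⁻ x, supportPow Q p (transposeMul u (hG.mk G x)) ∂μ) ^ (p⁻¹) := by
    ext u
    rw [← gradGauge_rpow Q hp, ENNReal.rpow_rpow_inv hp0]
  rw [this]
  exact (Measurable.lintegral_prod_right'
    (measurable_supportPow_transposeMul Q p hG.stronglyMeasurable_mk.measurable)).pow_const _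

theorem gradGauge_smul (Q : ConvexBody (Euc m)) (p : ℝ) (t : ℝ) (u : Mat n m) (ht : 0 < t) :
    gradGauge Q p μ G (t • u) = ENNReal.ofReal t * gradGauge Q p μ G u := by
  simp only [gradGauge, transposeMul_smul_left, supportFun_smul Q ht.le]
  rw [show (fun x => t * supportFun Q (transposeMul u (G x))) =
    t • fun x => supportFun Q (transposeMul u (G x)) from rfl, eLpNorm_const_smul,
    Real.enorm_of_nonneg ht.le]

theorem finrank_mat : Module.finrank ℝ (Mat n m) = n * m := by simp

theorem nontrivial_mat (hn : 1 ≤ n) (hm : 1 ≤ m) : Nontrivial (Mat n m) :=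
  Module.nontrivial_of_finrank_pos (R := ℝ) (by rw [finrank_mat]; positivity)

theorem lintegral_sphere_gradGauge [SFinite μ] (hn : 1 ≤ n) (hm : 1 ≤ m)
    (Q : ConvexBody (Euc m)) {p : ℝ} (hp : 1 ≤ p) (hG : AEStronglyMeasurable G μ) :
    ∫⁻ θ : Metric.sphere (0 : Mat n m) 1, gradGauge Q p μ G θ ^ (-((n : ℝ) * (m : ℝ)))
      ∂(volume : Measure (Mat n m)).toSphere =
    (n : ℝ≥0∞) * (m : ℝ≥0∞) * volume {u : Mat n m | gradGauge Q p μ G u ≤ 1} := by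
  have := nontrivial_mat hn hm
  have h := lintegral_sphere_rpow_neg (volume : Measure (Mat n m)) (measurable_gradGauge Q hp hG)
    (fun t u ht => gradGauge_smul Q p t u ht)
  rw [finrank_mat] at h
  push_cast at h
  exact h

/-- As `Q` contains a ball, the gauge dominates the scalar directional derivative along each single
column, to which the Poincaré inequality applies. -/
theorem ofReal_mul_eLpNorm_inner_le_gradGauge (Q : ConvexBody (Euc m)) (p : ℝ) {r : ℝ}
    (hr : 0 ≤ r) (h : ∀ y, r * ‖y‖ ≤ supportFun Q y) (u : Mat n m) (j : Fin m) :
    ENNReal.ofReal r * eLpNorm (fun x => inner ℝ (col u j) (G x)) (ENNReal.ofReal p) μ ≤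
      gradGauge Q p μ G u := by
  rw [← Real.enorm_of_nonneg hr, ← eLpNorm_const_smul]
  refine eLpNorm_mono fun x => ?_
  simp only [Pi.smul_apply, smul_eq_mul, norm_mul, Real.norm_eq_abs, abs_of_nonneg hr]
  exact (mul_le_mul_of_nonneg_left (abs_inner_col_le u (G x) j) hr).trans
    ((h _).trans (le_abs_self _))

theorem gradGauge_le (Q : ConvexBody (Euc m)) (p : ℝ) {R r : ℝ} (hR : 0 ≤ R) (hr : 0 ≤ r)
    (h : ∀ y, supportFun Q y ≤ R * ‖y‖) (h' : ∀ y, r * ‖y‖ ≤ supportFun Q y) (u : Mat n m) :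
    gradGauge Q p μ G u ≤
      ENNReal.ofReal (R * ‖u‖) * eLpNorm G (ENNReal.ofReal p) μ := by
  rw [← Real.enorm_of_nonneg (by positivity), ← eLpNorm_const_smul]
  refine eLpNorm_mono fun x => ?_
  simp only [Pi.smul_apply, norm_smul, norm_mul, Real.norm_eq_abs, abs_of_nonneg hR, abs_norm]
  rw [abs_of_nonneg ((mul_nonneg hr (norm_nonneg _)).trans (h' _)), mul_assoc]
  exact (h _).trans (mul_le_mul_of_nonneg_left (norm_transposeMul_le _ _) hR)

end Gauge

/-! ### Rotation invariance of spherical integrals -/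

section Rotation

open Measure
open scoped Pointwise

/-- The action of a linear isometry on a unit sphere. -/
def sphereMap {E : Type*} [NormedAddCommGroup E] [NormedSpace ℝ E] (T : E ≃ₗᵢ[ℝ] E)
    (θ : Metric.sphere (0 : E) 1) : Metric.sphere (0 : E) 1 :=
  ⟨T θ, by simp⟩

theorem measurePreserving_sphereMap {E : Type*} [NormedAddCommGroup E] [NormedSpace ℝ E]
    [MeasurableSpace E] [BorelSpace E] {μ : Measure E} (T : E ≃ₗᵢ[ℝ] E)
    (hT : MeasurePreserving T μ μ) : MeasurePreserving (sphereMap T) μ.toSphere μ.toSphere := by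
  have hc : Measurable (sphereMap T) :=
    (T.continuous.comp continuous_subtype_val).measurable.subtype_mk
  refine ⟨hc, ?_⟩
  ext s hs
  -- Spherical measure is the dimension times the volume of the cone over the set, and `T` carries
  -- cones to cones.
  rw [map_apply hc hs, toSphere_apply' _ hs, toSphere_apply' _ (hc hs),
    ← hT.measure_preimage_equiv (f := T.toHomeomorph.toMeasurableEquiv) (Set.Ioo 0 1 • _ '' s)]
  congr 2
  ext x
  simp only [Set.mem_smul, Set.mem_image, Set.mem_preimage]
  constructor
  · rintro ⟨t, ht, _, ⟨θ, hθ, rfl⟩, rfl⟩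
    exact ⟨t, ht, _, ⟨_, hθ, rfl⟩, (map_smul T t (θ : E)).symm⟩
  · rintro ⟨t, ht, _, ⟨θ, hθ, rfl⟩, h⟩
    refine ⟨t, ht, _, ⟨sphereMap T.symm θ, ?_, rfl⟩, ?_⟩
    · convert! hθ
      ext1
      simp [sphereMap]
    · apply T.injective
      change t • (θ : E) = T x at h
      rw [map_smul, ← h]
      simp [sphereMap]

variable {n m : ℕ}

/-- The action of a linear isometry on the columns of a matrix. -/
def colMap (R : Euc n ≃ₗᵢ[ℝ] Euc n) : Mat n m ≃ₗᵢ[ℝ] Mat n m where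
  toFun u := WithLp.toLp 2 fun k => R (col u k.2) k.1
  invFun u := WithLp.toLp 2 fun k => R.symm (col u k.2) k.1
  map_add' u v := by ext k; simp [col_add]
  map_smul' t u := by ext k; simp [col_smul]
  left_inv u := by
    ext k
    simp only [col]
    exact congrArg (fun v : Euc n => v k.1) (R.symm_apply_apply (col u k.2))
  right_inv u := by
    ext k
    simp only [col]
    exact congrArg (fun v : Euc n => v k.1) (R.apply_symm_apply (col u k.2))
  norm_map' u := by
    refine (sq_eq_sq₀ (norm_nonneg _) (norm_nonneg _)).1 ?_
    rw [norm_sq_eq_sum_col, norm_sq_eq_sum_col]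
    refine Finset.sum_congr rfl fun j _ => ?_
    rw [← R.norm_map (col u j)]
    rfl

/-- Because `RᵗR = 1`, a rotation of `v` can be moved onto the columns of `θ`; the factor `ℝᵐ`,
where `Q` lives, is untouched. -/
theorem transposeMul_colMap (R : Euc n ≃ₗᵢ[ℝ] Euc n) (u : Mat n m) (v : Euc n) :
    transposeMul (colMap R u) (R v) = transposeMul u v := by
  ext j
  rw [transposeMul_apply, transposeMul_apply, ← R.inner_map_map (col u j) v]
  rfl

theorem exists_isometry_apply_eq {v w : Euc n} (h : ‖v‖ = ‖w‖) :
    ∃ R : Euc n ≃ₗᵢ[ℝ] Euc n, R v = w :=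
  ⟨_, Submodule.reflection_sub h⟩

theorem lintegral_sphere_comp {E : Type*} [NormedAddCommGroup E] [InnerProductSpace ℝ E]
    [MeasurableSpace E] [BorelSpace E] [FiniteDimensional ℝ E] (T : E ≃ₗᵢ[ℝ] E) {F : E → ℝ≥0∞}
    (hF : Measurable F) :
    ∫⁻ θ : Metric.sphere (0 : E) 1, F (T θ) ∂(volume : Measure E).toSphere =
      ∫⁻ θ : Metric.sphere (0 : E) 1, F θ ∂(volume : Measure E).toSphere :=
  (measurePreserving_sphereMap T T.measurePreserving).lintegral_comp
    (f := fun θ : Metric.sphere (0 : E) 1 => F θ) (hF.comp measurable_subtype_coe)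

theorem lintegral_sphere_inner_rpow {p : ℝ} (hp : 0 ≤ p) {e : Euc n} (he : ‖e‖ = 1) (w : Euc n) :
    ∫⁻ v : Metric.sphere (0 : Euc n) 1, ‖inner ℝ w (v : Euc n)‖ₑ ^ p
        ∂(volume : Measure (Euc n)).toSphere =
      ‖w‖ₑ ^ p * ∫⁻ v : Metric.sphere (0 : Euc n) 1, ‖inner ℝ e (v : Euc n)‖ₑ ^ p
        ∂(volume : Measure (Euc n)).toSphere := by
  obtain ⟨R, hR⟩ := exists_isometry_apply_eq (v := ‖w‖ • e) (w := w) (by simp [norm_smul, he])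
  rw [← lintegral_sphere_comp R (F := fun v => ‖inner ℝ w v‖ₑ ^ p) (by fun_prop),
    ← lintegral_const_mul _ (by fun_prop)]
  refine lintegral_congr fun v => ?_
  rw [← hR, R.inner_map_map, real_inner_smul_left, enorm_mul, ENNReal.mul_rpow_of_nonneg _ _ hp,
    hR, enorm_norm]

theorem toSphere_volume_ne_zero (hn : 1 ≤ n) : (volume : Measure (Euc n)).toSphere ≠ 0 := by
  have : Nontrivial (Euc n) :=
    Module.nontrivial_of_finrank_pos (R := ℝ) (by rw [finrank_euclideanSpace_fin]; exact hn)
  exact toSphere_ne_zero _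

/-- By rotation invariance, vanishing for one unit vector would make every coordinate vanish almost
everywhere on the sphere. -/
theorem lintegral_sphere_inner_rpow_ne_zero (hn : 1 ≤ n) {p : ℝ} (hp : 0 < p) {e : Euc n}
    (he : ‖e‖ = 1) :
    ∫⁻ v : Metric.sphere (0 : Euc n) 1, ‖inner ℝ e (v : Euc n)‖ₑ ^ p
      ∂(volume : Measure (Euc n)).toSphere ≠ 0 := by
  intro h0
  have h1 : ∀ i : Fin n, ∀ᵐ v : Metric.sphere (0 : Euc n) 1 ∂(volume : Measure (Euc n)).toSphere,
      (v : Euc n) i = 0 := fun i => by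
    have := lintegral_sphere_inner_rpow hp.le he (EuclideanSpace.single i (1 : ℝ))
    rw [h0, mul_zero, lintegral_eq_zero_iff (by fun_prop)] at this
    filter_upwards [this] with v hv
    simpa [EuclideanSpace.inner_single_left, hp, hp.not_gt] using hv
  have h2 : ∀ᵐ v : Metric.sphere (0 : Euc n) 1 ∂(volume : Measure (Euc n)).toSphere, False := by
    filter_upwards [ae_all_iff.2 h1] with v hv
    have : (v : Euc n) = 0 := by ext i; exact hv i
    have hv1 := norm_eq_of_mem_sphere v
    rw [this] at hv1
    simp at hv1
  rw [eventually_false_iff_eq_bot, ae_eq_bot] at h2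
  exact toSphere_volume_ne_zero hn h2

end Rotation

/-! ### The affine energy is at most the `L^p` norm of the gradient -/

section UpperBound

open Measure

variable {n m : ℕ}

/-- Weighted AM-GM with weights `1/(1+s)` and `s/(1+s)`, chosen so that the powers of `x` cancel in
the geometric mean. -/
theorem one_add_le_rpow_neg_add_mul {s x : ℝ} (hs : 0 < s) (hx : 0 < x) :
    1 + s ≤ x ^ (-s) + s * x := by
  have h := Real.geom_mean_le_arith_mean2_weighted (w₁ := 1 / (1 + s)) (w₂ := s / (1 + s))
    (p₁ := x ^ (-s)) (p₂ := x) (by positivity) (by positivity) (by positivity) hx.le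
    (by field_simp)
  rw [← Real.rpow_mul hx.le, ← Real.rpow_add hx] at h
  have h0 : -s * (1 / (1 + s)) + s / (1 + s) = 0 := by field_simp; ring
  rw [h0, Real.rpow_zero] at h
  have h2 := mul_le_mul_of_nonneg_left h (by positivity : 0 ≤ 1 + s)
  refine (le_of_eq (by ring)).trans (h2.trans (le_of_eq ?_))
  field_simp

/-- The tangent line inequality for `x ↦ x ^ (-s)`. -/
theorem ofReal_one_add_mul_rpow_neg_le {s : ℝ} (hs : 0 < s) (a : ℝ≥0∞) {b : ℝ≥0∞} (hb : b ≠ 0)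
    (hb' : b ≠ ⊤) :
    ENNReal.ofReal (1 + s) * b ^ (-s) ≤ a ^ (-s) + ENNReal.ofReal s * (b ^ (-s - 1) * a) := by
  rcases eq_or_ne a 0 with rfl | ha
  · rw [ENNReal.zero_rpow_of_neg (by linarith)]; simp
  rcases eq_or_ne a ⊤ with rfl | ha'
  · rw [ENNReal.mul_top, ENNReal.mul_top]
    · simp
    · simpa using hs
    · exact (ENNReal.rpow_pos (pos_iff_ne_zero.2 hb) hb').ne'
  lift a to ℝ≥0 using ha'
  lift b to ℝ≥0 using hb'
  have ha0 : (0 : ℝ) < a := by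
    have : 0 < a := pos_iff_ne_zero.2 (by simpa using ha)
    exact this
  have hb0 : (0 : ℝ) < b := by
    have : 0 < b := pos_iff_ne_zero.2 (by simpa using hb)
    exact this
  -- By homogeneity the tangent at `b` is the tangent at `1` evaluated at `a / b` and multiplied by
  -- `b^(-s)`.
  have h := one_add_le_rpow_neg_add_mul hs (div_pos ha0 hb0)
  have h3 := mul_le_mul_of_nonneg_right h (Real.rpow_nonneg hb0.le (-s))
  rw [Real.div_rpow ha0.le hb0.le] at h3
  have h4 : (1 + s) * (b : ℝ) ^ (-s) ≤ (a : ℝ) ^ (-s) + s * ((b : ℝ) ^ (-s - 1) * a) := by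
    refine h3.trans (le_of_eq ?_)
    rw [Real.rpow_sub hb0, Real.rpow_one]
    have : (b : ℝ) ^ (-s) ≠ 0 := (Real.rpow_pos_of_pos hb0 _).ne'
    field_simp
  rw [← ENNReal.ofReal_coe_nnreal (p := a), ← ENNReal.ofReal_coe_nnreal (p := b),
    ENNReal.ofReal_rpow_of_pos hb0, ENNReal.ofReal_rpow_of_pos ha0, ENNReal.ofReal_rpow_of_pos hb0,
    ← ENNReal.ofReal_mul (by positivity), ← ENNReal.ofReal_mul (by positivity),
    ← ENNReal.ofReal_mul (by positivity), ← ENNReal.ofReal_add (by positivity) (by positivity)]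
  exact ENNReal.ofReal_le_ofReal h4

/-- The gauge of the polar projection body of the unit ball. -/
def ballGauge (n : ℕ) (Q : ConvexBody (Euc m)) (p : ℝ) : Mat n m → ℝ≥0∞ :=
  gradGauge Q p (volume : Measure (Euc n)).toSphere
    (fun v : Metric.sphere (0 : Euc n) 1 => (v : Euc n))

theorem measurable_ballGauge (Q : ConvexBody (Euc m)) {p : ℝ} (hp : 1 ≤ p) :
    Measurable (ballGauge n Q p) :=
  measurable_gradGauge Q hp measurable_subtype_coe.aestronglyMeasurable

theorem ballGauge_colMap (Q : ConvexBody (Euc m)) {p : ℝ} (hp : 1 ≤ p) (R : Euc n ≃ₗᵢ[ℝ] Euc n)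
    (u : Mat n m) : ballGauge n Q p (colMap R u) = ballGauge n Q p u := by
  have hp0 : 0 < p := by linarith
  refine (ENNReal.rpow_left_injective hp0.ne') ?_
  simp only [ballGauge]
  rw [gradGauge_rpow Q hp, gradGauge_rpow Q hp]
  rw [← lintegral_sphere_comp R (F := fun v => supportPow Q p (transposeMul (colMap R u) v))]
  · simp only [transposeMul_colMap]
  · exact (measurable_supportPow Q p).comp
      (continuous_transposeMul.comp (by fun_prop : Continuous fun v : Euc n =>
        (colMap R u, v))).measurable

theorem exists_ballGauge_le (Q : ConvexBody (Euc m))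
    (hQ : (0 : Euc m) ∈ interior (Q : Set (Euc m))) (p : ℝ) : ∃ c : ℝ≥0∞, c ≠ ⊤ ∧
      ∀ θ : Metric.sphere (0 : Mat n m) 1, ballGauge n Q p θ ≤ c := by
  obtain ⟨R, hR, h⟩ := exists_supportFun_le Q
  obtain ⟨r, hr, h'⟩ := exists_le_supportFun Q hQ
  have hmem : MemLp (fun v : Metric.sphere (0 : Euc n) 1 => (v : Euc n)) (ENNReal.ofReal p)
      (volume : Measure (Euc n)).toSphere :=
    MemLp.of_bound measurable_subtype_coe.aestronglyMeasurable 1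
      (.of_forall fun v => (norm_eq_of_mem_sphere v).le)
  refine ⟨ENNReal.ofReal (R * 1) * eLpNorm (fun v : Metric.sphere (0 : Euc n) 1 => (v : Euc n))
    (ENNReal.ofReal p) (volume : Measure (Euc n)).toSphere,
    ENNReal.mul_ne_top (by simp) hmem.eLpNorm_ne_top, fun θ => ?_⟩
  have := gradGauge_le (μ := (volume : Measure (Euc n)).toSphere)
    (G := fun v : Metric.sphere (0 : Euc n) 1 => (v : Euc n)) Q p hR.le hr.le h h' (θ : Mat n m)
  rwa [norm_eq_of_mem_sphere θ] at this

/-- The squared column norms sum to `1`. The bound `1/m` is weaker than the optimal `1/√m` but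
avoids a square root. -/
theorem exists_one_le_mul_norm_col (hm : 1 ≤ m) (θ : Metric.sphere (0 : Mat n m) 1) :
    ∃ j, 1 ≤ (m : ℝ) * ‖col (θ : Mat n m) j‖ := by
  by_contra! h
  have hm0 : (0 : ℝ) < m := by exact_mod_cast hm
  have hm1 : (1 : ℝ) ≤ m := by exact_mod_cast hm
  have h1 := norm_sq_eq_sum_col (θ : Mat n m)
  rw [norm_eq_of_mem_sphere θ] at h1
  have h2 : ∑ j, ‖col (θ : Mat n m) j‖ ^ 2 < ∑ j : Fin m, 1 / (m : ℝ) := by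
    refine Finset.sum_lt_sum_of_nonempty ⟨⟨0, hm⟩, Finset.mem_univ _⟩ fun j _ => ?_
    have := h j
    rw [lt_div_iff₀ hm0]
    have h0 := norm_nonneg (col (θ : Mat n m) j)
    have h5 : ‖col (θ : Mat n m) j‖ ≤ 1 := by nlinarith
    nlinarith
  rw [Finset.sum_const, Finset.card_univ, Fintype.card_fin, nsmul_eq_mul,
    mul_one_div_cancel hm0.ne'] at h2
  linarith

/-- Some column has norm at least `1/m`, and `∫ |⟨w, v⟩|^p dv` scales as `‖w‖^p` with a nonzero
factor. The uniform bound makes `ballIntegral` finite. -/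
theorem exists_le_ballGauge (hn : 1 ≤ n) (hm : 1 ≤ m) (Q : ConvexBody (Euc m))
    (hQ : (0 : Euc m) ∈ interior (Q : Set (Euc m))) {p : ℝ} (hp : 1 ≤ p) : ∃ c : ℝ≥0∞, c ≠ 0 ∧
      ∀ θ : Metric.sphere (0 : Mat n m) 1, c ≤ ballGauge n Q p θ := by
  obtain ⟨r, hr, h⟩ := exists_le_supportFun Q hQ
  have hp0 : 0 < p := by linarith
  have hm0 : (0 : ℝ) < m := by exact_mod_cast hm
  set e : Euc n := EuclideanSpace.single ⟨0, hn⟩ (1 : ℝ)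
  have he : ‖e‖ = 1 := by simp [e]
  set I := ∫⁻ v : Metric.sphere (0 : Euc n) 1, ‖inner ℝ e (v : Euc n)‖ₑ ^ p
    ∂(volume : Measure (Euc n)).toSphere
  have hI : I ≠ 0 := lintegral_sphere_inner_rpow_ne_zero hn hp0 he
  refine ⟨ENNReal.ofReal r * (ENNReal.ofReal (1 / m) * I ^ p⁻¹), ?_, fun θ => ?_⟩
  · refine mul_ne_zero (by simpa using hr) (mul_ne_zero ?_ ?_)
    · simpa [Nat.pos_iff_ne_zero] using hm0
    · simp [hI, hp0.le]
  · obtain ⟨j, hj⟩ := exists_one_le_mul_norm_col hm θ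
    refine le_trans ?_ (ofReal_mul_eLpNorm_inner_le_gradGauge Q p hr.le h (θ : Mat n m) j)
    gcongr
    rw [← ENNReal.rpow_le_rpow_iff hp0, eLpNorm_ofReal_rpow hp,
      lintegral_sphere_inner_rpow hp0.le he, ENNReal.mul_rpow_of_nonneg _ _ hp0.le,
      ENNReal.rpow_inv_rpow hp0.ne']
    gcongr
    rw [← ofReal_norm]
    apply ENNReal.ofReal_le_ofReal
    rwa [div_le_iff₀ hm0, mul_comm]

variable (n) in
/-- The integral `∫ g ^ (-nm)` over the unit sphere of matrices for the gauge `g` of the polar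
projection body of the ball. -/
def ballIntegral (Q : ConvexBody (Euc m)) (p : ℝ) : ℝ≥0∞ :=
  ∫⁻ θ : Metric.sphere (0 : Mat n m) 1, ballGauge n Q p θ ^ (-((n : ℝ) * (m : ℝ)))
    ∂(volume : Measure (Mat n m)).toSphere

theorem ballIntegral_eq (hn : 1 ≤ n) (hm : 1 ≤ m) (Q : ConvexBody (Euc m)) {p : ℝ} (hp : 1 ≤ p) :
    ballIntegral n Q p =
      (n : ℝ≥0∞) * (m : ℝ≥0∞) * volume (polarProjectionBall n Q p) :=
  lintegral_sphere_gradGauge hn hm Q hp measurable_subtype_coe.aestronglyMeasurable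

theorem toSphere_mat_ne_zero (hn : 1 ≤ n) (hm : 1 ≤ m) :
    (volume : Measure (Mat n m)).toSphere ≠ 0 := by
  have := nontrivial_mat hn hm
  exact toSphere_ne_zero _

theorem ballIntegral_ne_top (hn : 1 ≤ n) (hm : 1 ≤ m) (Q : ConvexBody (Euc m))
    (hQ : (0 : Euc m) ∈ interior (Q : Set (Euc m))) {p : ℝ} (hp : 1 ≤ p) :
    ballIntegral n Q p ≠ ⊤ := by
  obtain ⟨c, hc, h⟩ := exists_le_ballGauge hn hm Q hQ hp
  refine ne_top_of_le_ne_top ?_ (lintegral_mono (g := fun _ => c ^ (-((n : ℝ) * (m : ℝ))))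
    fun θ => ?_)
  · rw [lintegral_const]
    refine ENNReal.mul_ne_top ?_ (measure_ne_top _ _)
    rw [ENNReal.rpow_neg]
    simp [hc, ENNReal.rpow_eq_zero_iff]
    intro _
    positivity
  · dsimp only
    rw [ENNReal.rpow_neg, ENNReal.rpow_neg, ENNReal.inv_le_inv]
    gcongr
    exact h θ

theorem ballIntegral_ne_zero (hn : 1 ≤ n) (hm : 1 ≤ m) (Q : ConvexBody (Euc m))
    (hQ : (0 : Euc m) ∈ interior (Q : Set (Euc m))) (p : ℝ) :
    ballIntegral n Q p ≠ 0 := by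
  obtain ⟨c, hc, h⟩ := exists_ballGauge_le (n := n) Q hQ p
  refine ne_of_gt (lt_of_lt_of_le ?_ (lintegral_mono (f := fun _ => c ^ (-((n : ℝ) * (m : ℝ))))
    fun θ => ?_))
  · rw [lintegral_const]
    refine ENNReal.mul_pos ?_ (measure_univ_ne_zero.2 (toSphere_mat_ne_zero hn hm))
    rw [ENNReal.rpow_neg]
    simp only [ne_eq, ENNReal.inv_eq_zero]
    exact ENNReal.rpow_ne_top_of_nonneg (by positivity) hc
  · dsimp only
    rw [ENNReal.rpow_neg, ENNReal.rpow_neg, ENNReal.inv_le_inv]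
    gcongr
    exact h θ

theorem toSphere_univ_eq (hn : 1 ≤ n) : (volume : Measure (Euc n)).toSphere Set.univ =
    (n : ℝ≥0∞) * volume (Metric.closedBall (0 : Euc n) 1) := by
  have : Nontrivial (Euc n) :=
    Module.nontrivial_of_finrank_pos (R := ℝ) (by rw [finrank_euclideanSpace_fin]; exact hn)
  rw [toSphere_apply_univ, finrank_euclideanSpace_fin, addHaar_closedBall_eq_addHaar_ball]

theorem normConst_eq (hn : 1 ≤ n) (hm : 1 ≤ m) (Q : ConvexBody (Euc m)) {p : ℝ} (hp : 1 ≤ p) :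
    normConst n Q p = (volume : Measure (Euc n)).toSphere Set.univ ^ (1 / p) *
      ballIntegral n Q p ^ (1 / ((n : ℝ) * (m : ℝ))) := by
  rw [normConst, toSphere_univ_eq hn, ballIntegral_eq hn hm Q hp]

theorem normConst_ne_zero (hn : 1 ≤ n) (hm : 1 ≤ m) (Q : ConvexBody (Euc m))
    (hQ : (0 : Euc m) ∈ interior (Q : Set (Euc m))) {p : ℝ} (hp : 1 ≤ p) :
    normConst n Q p ≠ 0 := by
  have hp0 : 0 ≤ p := by linarith
  rw [normConst_eq hn hm Q hp]
  refine mul_ne_zero ?_ ?_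
  · exact (ENNReal.rpow_pos_of_nonneg
      (pos_iff_ne_zero.2 (measure_univ_ne_zero.2 (toSphere_volume_ne_zero hn)))
      (by positivity)).ne'
  · exact (ENNReal.rpow_pos_of_nonneg (pos_iff_ne_zero.2 (ballIntegral_ne_zero hn hm Q hQ p))
      (by positivity)).ne'

theorem normConst_ne_top (hn : 1 ≤ n) (hm : 1 ≤ m) (Q : ConvexBody (Euc m))
    (hQ : (0 : Euc m) ∈ interior (Q : Set (Euc m))) {p : ℝ} (hp : 1 ≤ p) :
    normConst n Q p ≠ ⊤ := by
  have hp0 : 0 ≤ p := by linarith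
  rw [normConst_eq hn hm Q hp]
  exact ENNReal.mul_ne_top (ENNReal.rpow_ne_top_of_nonneg (by positivity) (measure_ne_top _ _))
    (ENNReal.rpow_ne_top_of_nonneg (by positivity) (ballIntegral_ne_top hn hm Q hQ hp))

/-- A rotation invariant weight gives a `p`-homogeneous radial function of `v`. -/
theorem lintegral_weight_mul_supportPow (Q : ConvexBody (Euc m)) {p : ℝ} (hp : 0 ≤ p)
    {W : Mat n m → ℝ≥0∞} (hW : Measurable W)
    (hinv : ∀ (R : Euc n ≃ₗᵢ[ℝ] Euc n) u, W (colMap R u) = W u) {e : Euc n} (he : ‖e‖ = 1)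
    (v : Euc n) :
    ∫⁻ θ : Metric.sphere (0 : Mat n m) 1, W θ * supportPow Q p (transposeMul (θ : Mat n m) v)
        ∂(volume : Measure (Mat n m)).toSphere =
      ‖v‖ₑ ^ p * ∫⁻ θ : Metric.sphere (0 : Mat n m) 1,
        W θ * supportPow Q p (transposeMul (θ : Mat n m) e)
        ∂(volume : Measure (Mat n m)).toSphere := by
  obtain ⟨R, hR⟩ := exists_isometry_apply_eq (v := ‖v‖ • e) (w := v) (by simp [norm_smul, he])
  have hmeas : ∀ w : Euc n, Measurable fun u : Mat n m => supportPow Q p (transposeMul u w) :=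
    fun w => (measurable_supportPow Q p).comp
      (continuous_transposeMul.comp (by fun_prop : Continuous fun u : Mat n m => (u, w))).measurable
  have hWe : Measurable fun θ : Metric.sphere (0 : Mat n m) 1 =>
      W θ * supportPow Q p (transposeMul (θ : Mat n m) e) :=
    (hW.mul (hmeas e)).comp measurable_subtype_coe
  rw [← lintegral_sphere_comp (colMap R) (F := fun u => W u * supportPow Q p (transposeMul u v))
    (hW.mul (hmeas v)), ← lintegral_const_mul _ hWe]
  refine lintegral_congr fun θ => ?_
  rw [hinv]
  conv_lhs => rw [← hR]
  rw [transposeMul_colMap, transposeMul_smul_right, supportPow_smul Q hp (norm_nonneg v),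
    ofReal_norm]
  ring

/-- Tonelli reduces to a fixed vector `G x`. The last factor does not involve `(X, μ, G)`, so a
gradient can be compared with the identity field on the sphere. -/
theorem lintegral_weight_mul_gradGauge (Q : ConvexBody (Euc m)) {p : ℝ} (hp : 1 ≤ p)
    {W : Mat n m → ℝ≥0∞} (hW : Measurable W)
    (hinv : ∀ (R : Euc n ≃ₗᵢ[ℝ] Euc n) u, W (colMap R u) = W u) {e : Euc n} (he : ‖e‖ = 1)
    {X : Type*} [MeasurableSpace X] {μ : Measure X} [SFinite μ] {G : X → Euc n}
    (hG : Measurable G) :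
    ∫⁻ θ : Metric.sphere (0 : Mat n m) 1, W θ * gradGauge Q p μ G θ ^ p
        ∂(volume : Measure (Mat n m)).toSphere =
      (∫⁻ x, ‖G x‖ₑ ^ p ∂μ) * ∫⁻ θ : Metric.sphere (0 : Mat n m) 1,
        W θ * supportPow Q p (transposeMul (θ : Mat n m) e)
        ∂(volume : Measure (Mat n m)).toSphere := by
  have hp0 : 0 ≤ p := by linarith
  have hmeas : Measurable fun z : Metric.sphere (0 : Mat n m) 1 × X =>
      supportPow Q p (transposeMul (z.1 : Mat n m) (G z.2)) :=
    (measurable_supportPow_transposeMul Q p hG).comp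
      (f := fun z : Metric.sphere (0 : Mat n m) 1 × X => ((z.1 : Mat n m), z.2)) (by fun_prop)
  have hmeas' : Measurable fun z : Metric.sphere (0 : Mat n m) 1 × X =>
      W (z.1 : Mat n m) * supportPow Q p (transposeMul (z.1 : Mat n m) (G z.2)) :=
    Measurable.mul (f := fun z : Metric.sphere (0 : Mat n m) 1 × X => W (z.1 : Mat n m))
      (by fun_prop) hmeas
  have hGm : Measurable fun x => ‖G x‖ₑ ^ p := hG.enorm.pow_const p
  calc _ = ∫⁻ θ : Metric.sphere (0 : Mat n m) 1, ∫⁻ x,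
        W θ * supportPow Q p (transposeMul (θ : Mat n m) (G x)) ∂μ
        ∂(volume : Measure (Mat n m)).toSphere := by
        refine lintegral_congr fun θ => ?_
        have hc : Continuous fun v : Euc n => transposeMul (θ : Mat n m) v :=
          continuous_transposeMul.comp (by fun_prop : Continuous fun v => ((θ : Mat n m), v))
        have hθ : Measurable fun x => supportPow Q p (transposeMul (θ : Mat n m) (G x)) :=
          (measurable_supportPow Q p).comp (hc.measurable.comp hG)
        rw [gradGauge_rpow Q hp, lintegral_const_mul _ hθ]
    _ = ∫⁻ x, ∫⁻ θ : Metric.sphere (0 : Mat n m) 1,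
        W θ * supportPow Q p (transposeMul (θ : Mat n m) (G x))
        ∂(volume : Measure (Mat n m)).toSphere ∂μ :=
        lintegral_lintegral_swap hmeas'.aemeasurable
    _ = _ := by
        rw [← lintegral_mul_const _ hGm]
        exact lintegral_congr fun x => lintegral_weight_mul_supportPow Q hp0 hW hinv he (G x)

/-- A reverse Jensen-type comparison: among fields with given `L^p` norm, `∫ g^(-nm)` is least when
`g^p` is proportional to the `p`-th power of the gauge of the ball. -/
theorem rpow_mul_ballIntegral_le (hn : 1 ≤ n) (hm : 1 ≤ m) (Q : ConvexBody (Euc m))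
    (hQ : (0 : Euc m) ∈ interior (Q : Set (Euc m))) {p : ℝ} (hp : 1 ≤ p)
    {X : Type*} [MeasurableSpace X] {μ : Measure X} [SFinite μ] {G : X → Euc n}
    (hG : Measurable G) {t : ℝ≥0∞} (ht : t ≠ 0) (ht' : t ≠ ⊤)
    (htG : ∫⁻ x, ‖G x‖ₑ ^ p ∂μ = t * (volume : Measure (Euc n)).toSphere Set.univ) :
    t ^ (-((n : ℝ) * (m : ℝ) / p)) * ballIntegral n Q p ≤
      ∫⁻ θ : Metric.sphere (0 : Mat n m) 1, gradGauge Q p μ G θ ^ (-((n : ℝ) * (m : ℝ)))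
        ∂(volume : Measure (Mat n m)).toSphere := by
  have hp0 : 0 < p := by linarith
  have hn0 : (0 : ℝ) < n := by exact_mod_cast hn
  have hm0 : (0 : ℝ) < m := by exact_mod_cast hm
  set s : ℝ := (n : ℝ) * (m : ℝ) / p with hs
  have hs0 : 0 < s := by positivity
  have hps : ∀ x : ℝ≥0∞, x ^ (-((n : ℝ) * (m : ℝ))) = (x ^ p) ^ (-s) := fun x => by
    rw [← ENNReal.rpow_mul, hs]
    congr 1
    field_simp
  set σ := (volume : Measure (Mat n m)).toSphere
  set e : Euc n := EuclideanSpace.single ⟨0, hn⟩ (1 : ℝ)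
  have he : ‖e‖ = 1 := by simp [e]
  -- Up to a constant, `W` is the slope of `x ↦ x^(-s)` at `b^p`; it inherits the rotation
  -- invariance of the ball gauge `b`.
  set W : Mat n m → ℝ≥0∞ := fun u => (ballGauge n Q p u ^ p) ^ (-s - 1) with hWdef
  have hbm := measurable_ballGauge (n := n) Q hp
  have hW : Measurable W := (hbm.pow_const _).pow_const _
  have hinv : ∀ (R : Euc n ≃ₗᵢ[ℝ] Euc n) u, W (colMap R u) = W u := fun R u => by
    simp only [hWdef, ballGauge_colMap Q hp]
  obtain ⟨c, hc, hcl⟩ := exists_le_ballGauge hn hm Q hQ hp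
  obtain ⟨c', hc', hcl'⟩ := exists_ballGauge_le (n := n) Q hQ p
  have hb0 : ∀ θ : Metric.sphere (0 : Mat n m) 1, ballGauge n Q p θ ^ p ≠ 0 := fun θ =>
    (ENNReal.rpow_pos_of_nonneg ((pos_iff_ne_zero.2 hc).trans_le (hcl θ)) hp0.le).ne'
  have hbT : ∀ θ : Metric.sphere (0 : Mat n m) 1, ballGauge n Q p θ ^ p ≠ ⊤ := fun θ =>
    ENNReal.rpow_ne_top_of_nonneg hp0.le (ne_top_of_le_ne_top hc' (hcl' θ))
  have hA := lintegral_weight_mul_gradGauge Q hp hW hinv he (μ := μ) hG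
  have hB := lintegral_weight_mul_gradGauge Q hp hW hinv he
    (μ := (volume : Measure (Euc n)).toSphere)
    (G := fun v : Metric.sphere (0 : Euc n) 1 => (v : Euc n)) measurable_subtype_coe
  have hone : ∫⁻ v : Metric.sphere (0 : Euc n) 1, ‖(v : Euc n)‖ₑ ^ p
      ∂(volume : Measure (Euc n)).toSphere = (volume : Measure (Euc n)).toSphere Set.univ := by
    rw [← lintegral_one]
    refine lintegral_congr fun v => ?_
    rw [← ofReal_norm, norm_eq_of_mem_sphere v]
    simp
  have hK : ∫⁻ θ : Metric.sphere (0 : Mat n m) 1, W θ * ballGauge n Q p θ ^ p ∂σ =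
      ballIntegral n Q p := by
    refine lintegral_congr fun θ => ?_
    simp only [hWdef]
    rw [hps, ENNReal.rpow_sub _ _ (hb0 θ) (hbT θ), ENNReal.rpow_one,
      ENNReal.div_mul_cancel (hb0 θ) (hbT θ)]
  -- The identity field gives `K = M · const` for `K = ballIntegral n Q p`, which turns `hA` into `∫
  -- W g^p = t K`.
  change ∫⁻ θ : Metric.sphere (0 : Mat n m) 1, W θ * ballGauge n Q p θ ^ p ∂σ = _ at hB
  rw [hone, hK] at hB
  rw [htG, mul_assoc, ← hB] at hA
  have hpt : ∀ θ : Metric.sphere (0 : Mat n m) 1,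
      ENNReal.ofReal (1 + s) * (t ^ (-s) * ballGauge n Q p θ ^ (-((n : ℝ) * (m : ℝ)))) ≤
        gradGauge Q p μ G θ ^ (-((n : ℝ) * (m : ℝ))) +
          ENNReal.ofReal s * (t ^ (-s - 1) * (W θ * gradGauge Q p μ G θ ^ p)) := fun θ => by
    have h := ofReal_one_add_mul_rpow_neg_le hs0 (gradGauge Q p μ G θ ^ p)
      (mul_ne_zero ht (hb0 θ)) (ENNReal.mul_ne_top ht' (hbT θ))
    rw [ENNReal.mul_rpow_of_ne_top ht' (hbT θ), ENNReal.mul_rpow_of_ne_top ht' (hbT θ)] at h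
    rw [hps, hps, ← mul_assoc (t ^ (-s - 1))]
    exact h
  have hint := lintegral_mono (μ := σ) hpt
  have hgm : Measurable fun θ : Metric.sphere (0 : Mat n m) 1 => gradGauge Q p μ G θ :=
    (measurable_gradGauge Q hp hG.aestronglyMeasurable).comp measurable_subtype_coe
  have hWm : Measurable fun θ : Metric.sphere (0 : Mat n m) 1 => W θ :=
    hW.comp measurable_subtype_coe
  have hbm' : Measurable fun θ : Metric.sphere (0 : Mat n m) 1 => ballGauge n Q p θ :=
    hbm.comp measurable_subtype_coe
  rw [lintegral_const_mul _ (by fun_prop), lintegral_const_mul _ (by fun_prop),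
    lintegral_add_left (by fun_prop), lintegral_const_mul _ (by fun_prop),
    lintegral_const_mul _ (by fun_prop), hA] at hint
  have hJ : t ^ (-s - 1) * (t * ballIntegral n Q p) = t ^ (-s) * ballIntegral n Q p := by
    rw [← mul_assoc, ENNReal.rpow_sub _ _ ht ht', ENNReal.rpow_one,
      ENNReal.div_mul_cancel ht ht']
  rw [hJ, ENNReal.ofReal_add one_pos.le hs0.le, ENNReal.ofReal_one, add_mul, one_mul] at hint
  -- The term `s t^(-s) K` appears on both sides and may be cancelled because it is finite.
  refine ENNReal.le_of_add_le_add_right ?_ hint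
  refine ENNReal.mul_ne_top ENNReal.ofReal_ne_top (ENNReal.mul_ne_top ?_
    (ballIntegral_ne_top hn hm Q hQ hp))
  exact ENNReal.rpow_ne_top_of_ne_zero ht ht'

theorem affineEnergy_le (hn : 1 ≤ n) (hm : 1 ≤ m) (Q : ConvexBody (Euc m))
    (hQ : (0 : Euc m) ∈ interior (Q : Set (Euc m))) {p : ℝ} (hp : 1 ≤ p)
    {μ : Measure (Euc n)} [SFinite μ] {G : Euc n → Euc n} (hG : AEStronglyMeasurable G μ)
    (h0 : eLpNorm G (ENNReal.ofReal p) μ ≠ 0) (hT : eLpNorm G (ENNReal.ofReal p) μ ≠ ⊤) :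
    affineEnergy Q p μ G ≤ eLpNorm G (ENNReal.ofReal p) μ := by
  have hp0 : 0 < p := by linarith
  have hn0 : (0 : ℝ) < n := by exact_mod_cast hn
  have hm0 : (0 : ℝ) < m := by exact_mod_cast hm
  set D := eLpNorm G (ENNReal.ofReal p) μ with hD
  set M := (volume : Measure (Euc n)).toSphere Set.univ with hM
  set N : ℝ := (n : ℝ) * (m : ℝ) with hN
  have hN0 : 0 < N := by positivity
  set K := ballIntegral n Q p with hK
  have hK0 : K ≠ 0 := ballIntegral_ne_zero hn hm Q hQ p
  have hKT : K ≠ ⊤ := ballIntegral_ne_top hn hm Q hQ hp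
  have hM0 : M ≠ 0 := measure_univ_ne_zero.2 (toSphere_volume_ne_zero hn)
  have hMT : M ≠ ⊤ := measure_ne_top _ _
  have hDp0 : D ^ p ≠ 0 := (ENNReal.rpow_pos_of_nonneg (pos_iff_ne_zero.2 h0) hp0.le).ne'
  have hDpT : D ^ p ≠ ⊤ := ENNReal.rpow_ne_top_of_nonneg hp0.le hT
  have ht0 : D ^ p / M ≠ 0 := ENNReal.div_ne_zero.2 ⟨hDp0, hMT⟩
  have htT : D ^ p / M ≠ ⊤ := ENNReal.div_ne_top hDpT hM0
  have key := rpow_mul_ballIntegral_le hn hm Q hQ hp (μ := μ)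
    hG.stronglyMeasurable_mk.measurable ht0 htT (by
      rw [ENNReal.div_mul_cancel hM0 hMT, hD, eLpNorm_congr_ae hG.ae_eq_mk,
        eLpNorm_ofReal_rpow hp])
  rw [← gradGauge_congr Q p hG.ae_eq_mk] at key
  have hE : affineEnergy Q p μ G = normConst n Q p *
    (∫⁻ θ : Metric.sphere (0 : Mat n m) 1, gradGauge Q p μ G θ ^ (-N)
      ∂(volume : Measure (Mat n m)).toSphere) ^ (-(1 / N)) := rfl
  rw [hE, normConst_eq hn hm Q hp]
  calc _ ≤ M ^ (1 / p) * K ^ (1 / N) * ((D ^ p / M) ^ (-(N / p)) * K) ^ (-(1 / N)) := by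
        rw [ENNReal.rpow_neg, ENNReal.rpow_neg]
        gcongr
    _ = D := by
        have h1 : ((D ^ p / M) ^ (-(N / p)) * K) ^ (-(1 / N)) =
            (D ^ p / M) ^ (1 / p) * K ^ (-(1 / N)) := by
          rw [ENNReal.mul_rpow_of_ne_top (ENNReal.rpow_ne_top_of_ne_zero ht0 htT) hKT,
            ← ENNReal.rpow_mul]
          congr 2
          field_simp
        have h2 : M ^ (1 / p) * (D ^ p / M) ^ (1 / p) = D := by
          rw [← ENNReal.mul_rpow_of_nonneg _ _ (by positivity),
            ENNReal.mul_div_cancel hM0 hMT, one_div, ENNReal.rpow_rpow_inv hp0.ne']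
        have h3 : K ^ (1 / N) * K ^ (-(1 / N)) = 1 := by
          rw [← ENNReal.rpow_add _ _ hK0 hKT, add_neg_cancel, ENNReal.rpow_zero]
        rw [h1, mul_mul_mul_comm, h2, h3, mul_one]

end UpperBound

/-! ### Volume of the polar body and the lower bound for the energy -/

section LowerBound

open Measure Set

/-- A set in a box of side `2ρ` whose lines in one coordinate direction have length at most `ℓ`. -/
theorem volume_pi_le_of_slice {ι : Type*} [Fintype ι] [DecidableEq ι] {S : Set (ι → ℝ)}
    (hS : MeasurableSet S) {ρ ℓ : ℝ} (hbox : ∀ x ∈ S, ∀ k, |x k| ≤ ρ) (i : ι)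
    (hslice : ∀ x : ι → ℝ, ∀ s t : ℝ, Function.update x i s ∈ S → Function.update x i t ∈ S →
      |s - t| ≤ ℓ) :
    volume S ≤ ENNReal.ofReal ℓ * ENNReal.ofReal (2 * ρ) ^ (Fintype.card ι - 1) := by
  -- The comparison box has side `1` in direction `i`: on each line that meets `S`, the function `ℓ
  -- · 1_B` then integrates to at least `ℓ`, and `1_S` to at most `ℓ`.
  set J : ι → Set ℝ := fun k => if k = i then Icc 0 1 else Icc (-ρ) ρ with hJ
  set B : Set (ι → ℝ) := univ.pi J with hB
  have hBm : MeasurableSet B := MeasurableSet.univ_pi fun k => by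
    by_cases h : k = i <;> simp [hJ, h]
  have hf : Measurable (S.indicator (1 : (ι → ℝ) → ℝ≥0∞)) := measurable_one.indicator hS
  have hg : Measurable (B.indicator (fun _ : ι → ℝ => ENNReal.ofReal ℓ)) :=
    measurable_const.indicator hBm
  have key : ∀ x : ι → ℝ, ∫⁻ t, S.indicator (1 : (ι → ℝ) → ℝ≥0∞) (Function.update x i t) ≤
      ∫⁻ t, B.indicator (fun _ : ι → ℝ => ENNReal.ofReal ℓ) (Function.update x i t) := by
    intro x
    have hup : Measurable fun t : ℝ => Function.update x i t := measurable_update x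
    have e1 : (fun t => S.indicator (1 : (ι → ℝ) → ℝ≥0∞) (Function.update x i t)) =
        ((fun t => Function.update x i t) ⁻¹' S).indicator 1 := rfl
    have e2 : (fun t => B.indicator (fun _ : ι → ℝ => ENNReal.ofReal ℓ) (Function.update x i t)) =
        ((fun t => Function.update x i t) ⁻¹' B).indicator (fun _ => ENNReal.ofReal ℓ) := rfl
    rw [e1, e2, lintegral_indicator_one (hup hS), lintegral_indicator_const (hup hBm)]
    rcases ((fun t => Function.update x i t) ⁻¹' S).eq_empty_or_nonempty with h | ⟨t₀, ht₀⟩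
    · simp [h]
    have hsub : Icc (0 : ℝ) 1 ⊆ (fun t => Function.update x i t) ⁻¹' B := by
      intro t ht k _
      by_cases h : k = i
      · subst h; simpa [hJ] using ht
      · have : |Function.update x i t₀ k| ≤ ρ := hbox _ ht₀ k
        rw [Function.update_of_ne h] at this
        simpa [hJ, h] using abs_le.1 this
    have hvol : 1 ≤ volume ((fun t => Function.update x i t) ⁻¹' B) := by
      refine le_trans ?_ (measure_mono hsub)
      simp
    refine (Real.volume_le_diam _).trans ?_
    calc _ ≤ ENNReal.ofReal ℓ := by
          refine Metric.ediam_le fun s hs t ht => ?_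
          rw [edist_dist, Real.dist_eq]
          exact ENNReal.ofReal_le_ofReal (hslice x s t hs ht)
      _ ≤ _ := le_mul_of_one_le_right' hvol
  have hBvol : volume B = ENNReal.ofReal (2 * ρ) ^ (Fintype.card ι - 1) := by
    rw [hB, volume_pi_pi, ← Finset.mul_prod_erase _ _ (Finset.mem_univ i)]
    have h1 : volume (J i) = 1 := by simp [hJ]
    have h2 : ∀ k ∈ Finset.univ.erase i, volume (J k) = ENNReal.ofReal (2 * ρ) := fun k hk => by
      simp only [hJ, Finset.ne_of_mem_erase hk, if_false, Real.volume_Icc]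
      congr 1; ring
    rw [h1, one_mul, Finset.prod_congr rfl h2, Finset.prod_const, Finset.card_erase_of_mem
      (Finset.mem_univ i), Finset.card_univ]
  calc volume S = ∫⁻ x, S.indicator (1 : (ι → ℝ) → ℝ≥0∞) x := (lintegral_indicator_one hS).symm
    _ ≤ ∫⁻ x, B.indicator (fun _ : ι → ℝ => ENNReal.ofReal ℓ) x := by
        rw [volume_pi, lintegral_eq_lmarginal_univ (0 : ι → ℝ),
          lintegral_eq_lmarginal_univ (0 : ι → ℝ), lmarginal_erase' _ hf (Finset.mem_univ i),
          lmarginal_erase' _ hg (Finset.mem_univ i)]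
        exact lmarginal_mono key 0
    _ = _ := by rw [lintegral_indicator_const hBm, hBvol]

theorem volume_euclidean_le_of_slice {ι : Type*} [Fintype ι] [DecidableEq ι]
    {S : Set (EuclideanSpace ℝ ι)} (hS : MeasurableSet S) {ρ ℓ : ℝ}
    (hbox : ∀ x ∈ S, ∀ k, |x k| ≤ ρ) (i : ι)
    (hslice : ∀ x ∈ S, ∀ t : ℝ, x + t • EuclideanSpace.single i (1 : ℝ) ∈ S → |t| ≤ ℓ) :
    volume S ≤ ENNReal.ofReal ℓ * ENNReal.ofReal (2 * ρ) ^ (Fintype.card ι - 1) := by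
  rw [← (PiLp.volume_preserving_toLp ι).measure_preimage hS.nullMeasurableSet]
  refine volume_pi_le_of_slice ((PiLp.volume_preserving_toLp ι).measurable hS)
    (fun x hx k => hbox _ hx k) i fun x s t hs ht => ?_
  refine hslice _ ht (s - t) ?_
  have heq : WithLp.toLp 2 (Function.update x i t) + (s - t) • EuclideanSpace.single i (1 : ℝ) =
      WithLp.toLp 2 (Function.update x i s) := by
    ext k
    by_cases h : k = i
    · subst h; simp
    · simp [h]
  rw [heq]
  exact hs


variable {n m : ℕ} {X : Type*} [MeasurableSpace X] {μ : Measure X} {G : X → Euc n}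

theorem eLpNorm_inner_smul (q : ℝ≥0∞) (t : ℝ) (w : Euc n) :
    eLpNorm (fun x => inner ℝ (t • w) (G x)) q μ =
      ENNReal.ofReal |t| * eLpNorm (fun x => inner ℝ w (G x)) q μ := by
  simp_rw [real_inner_smul_left]
  rw [show (fun x => t * inner ℝ w (G x)) = t • fun x => inner ℝ w (G x) from rfl,
    eLpNorm_const_smul, Real.enorm_eq_ofReal_abs]

theorem eLpNorm_inner_le (q : ℝ≥0∞) (w : Euc n) :
    eLpNorm (fun x => inner ℝ w (G x)) q μ ≤ ENNReal.ofReal ‖w‖ * eLpNorm G q μ := by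
  rw [ofReal_norm, ← enorm_norm w, ← eLpNorm_const_smul]
  refine eLpNorm_mono fun x => ?_
  simp only [Pi.smul_apply, norm_smul, norm_norm]
  exact norm_inner_le_norm _ _

/-- Triangle inequality over the `n` coordinates of `G`, with `i` the coordinate of largest norm. -/
theorem exists_eLpNorm_le_card_mul (hn : 1 ≤ n) {q : ℝ≥0∞} (hq : 1 ≤ q)
    (hG : AEStronglyMeasurable G μ) :
    ∃ i : Fin n, eLpNorm G q μ ≤
      n * eLpNorm (fun x => inner ℝ (EuclideanSpace.single i (1 : ℝ)) (G x)) q μ := by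
  have : Nonempty (Fin n) := ⟨⟨0, hn⟩⟩
  obtain ⟨i, hi⟩ := Finite.exists_max fun i : Fin n =>
    eLpNorm (fun x => inner ℝ (EuclideanSpace.single i (1 : ℝ)) (G x)) q μ
  refine ⟨i, ?_⟩
  have hsum : G = ∑ i : Fin n, fun x =>
      (inner ℝ (EuclideanSpace.single i (1 : ℝ)) (G x) : ℝ) • EuclideanSpace.single i (1 : ℝ) := by
    ext x k
    simp [EuclideanSpace.inner_single_left, Finset.sum_apply, Pi.single_apply]
  conv_lhs => rw [hsum]
  refine (eLpNorm_sum_le (fun k _ => ?_) hq).trans ?_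
  · exact ((aestronglyMeasurable_const.inner hG).smul_const _)
  · calc _ ≤ ∑ _k : Fin n,
          eLpNorm (fun x => inner ℝ (EuclideanSpace.single i (1 : ℝ)) (G x)) q μ := by
          refine Finset.sum_le_sum fun k _ => le_trans (eLpNorm_mono fun x => ?_) (hi k)
          simp [norm_smul]
      _ = _ := by simp

/-- Volume bound for the polar body of a function that satisfies a Poincaré inequality in every
direction. -/
theorem volume_gradGauge_le (hn : 1 ≤ n) (hm : 1 ≤ m) [SFinite μ] (Q : ConvexBody (Euc m))
    {r : ℝ} (hr : 0 < r) (hrQ : ∀ y, r * ‖y‖ ≤ supportFun Q y) {p : ℝ} (hp : 1 ≤ p)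
    (hG : AEStronglyMeasurable G μ) {P D T : ℝ} (hP : 0 < P) (hD : 0 < D) (hT : 0 < T)
    (hDG : eLpNorm G (ENNReal.ofReal p) μ = ENNReal.ofReal D)
    (hPG : ∀ v : Euc n, ‖v‖ = 1 → ENNReal.ofReal P ≤
      ENNReal.ofReal T * eLpNorm (fun x => inner ℝ v (G x)) (ENNReal.ofReal p) μ) :
    volume {u : Mat n m | gradGauge Q p μ G u ≤ 1} ≤
      ENNReal.ofReal (2 * n / (r * D) * (2 * (T / (r * P))) ^ (n * m - 1)) := by
  have hp' : 1 ≤ ENNReal.ofReal p := by simpa using hp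
  have hn0 : (0 : ℝ) < n := by exact_mod_cast hn
  set L : Euc n → ℝ := fun w =>
    (eLpNorm (fun x => inner ℝ w (G x)) (ENNReal.ofReal p) μ).toReal with hL
  have hLT : ∀ w, eLpNorm (fun x => inner ℝ w (G x)) (ENNReal.ofReal p) μ ≠ ⊤ := fun w =>
    ne_top_of_le_ne_top (ENNReal.mul_ne_top ENNReal.ofReal_ne_top (by rw [hDG]; simp))
      (eLpNorm_inner_le _ w)
  have hLsmul : ∀ (t : ℝ) w, L (t • w) = |t| * L w := fun t w => by
    simp only [hL]
    rw [eLpNorm_inner_smul, ENNReal.toReal_mul, ENNReal.toReal_ofReal (abs_nonneg t)]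
  have hLsub : ∀ v w, L (v - w) ≤ L v + L w := fun v w => by
    simp only [hL]
    rw [← ENNReal.toReal_add (hLT v) (hLT w)]
    refine ENNReal.toReal_mono (ENNReal.add_ne_top.2 ⟨hLT v, hLT w⟩) ?_
    simp_rw [inner_sub_left]
    exact eLpNorm_sub_le (aestronglyMeasurable_const.inner hG)
      (aestronglyMeasurable_const.inner hG) hp'
  have hLP : ∀ w, ‖w‖ * P ≤ T * L w := fun w => by
    rcases eq_or_ne w 0 with rfl | hw
    · have : 0 ≤ L 0 := ENNReal.toReal_nonneg
      simp only [norm_zero, zero_mul]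
      positivity
    · have hw' : 0 < ‖w‖ := norm_pos_iff.2 hw
      have h := hPG (‖w‖⁻¹ • w) (norm_smul_inv_norm hw)
      have h2 := ENNReal.toReal_mono (ENNReal.mul_ne_top ENNReal.ofReal_ne_top (hLT _)) h
      rw [ENNReal.toReal_mul, ENNReal.toReal_ofReal hP.le, ENNReal.toReal_ofReal hT.le] at h2
      have h3 : P ≤ T * L (‖w‖⁻¹ • w) := h2
      rw [hLsmul, abs_of_pos (by positivity)] at h3
      calc ‖w‖ * P ≤ ‖w‖ * (T * (‖w‖⁻¹ * L w)) := by gcongr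
        _ = T * L w := by field_simp
  have hLg : ∀ u : Mat n m, gradGauge Q p μ G u ≤ 1 → ∀ j, r * L (col u j) ≤ 1 := fun u hu j => by
    have h := (ofReal_mul_eLpNorm_inner_le_gradGauge Q p hr.le hrQ u j).trans hu
    have h2 := ENNReal.toReal_mono ENNReal.one_ne_top h
    rwa [ENNReal.toReal_mul, ENNReal.toReal_ofReal hr.le, ENNReal.toReal_one] at h2
  obtain ⟨i, hi⟩ := exists_eLpNorm_le_card_mul hn hp' hG
  have hDi : D ≤ n * L (EuclideanSpace.single i 1) := by
    have h2 := ENNReal.toReal_mono (ENNReal.mul_ne_top (ENNReal.natCast_ne_top n) (hLT _)) hi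
    rwa [hDG, ENNReal.toReal_ofReal hD.le, ENNReal.toReal_mul, ENNReal.toReal_natCast] at h2
  have hmeas : MeasurableSet {u : Mat n m | gradGauge Q p μ G u ≤ 1} :=
    measurableSet_le (measurable_gradGauge Q hp hG) measurable_const
  -- The box: each entry is bounded by its column norm, which Poincaré and `r * L (col u j) ≤ 1`
  -- bound by `T / (r P)`.
  have hρ : ∀ u ∈ {u : Mat n m | gradGauge Q p μ G u ≤ 1}, ∀ k, |u k| ≤ T / (r * P) := by
    intro u hu k
    have h1 : |u k| ≤ ‖col u k.2‖ := PiLp.norm_apply_le (col u k.2) k.1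
    refine h1.trans ?_
    rw [le_div_iff₀ (by positivity)]
    have h2 := hLP (col u k.2)
    have h3 := hLg u hu k.2
    nlinarith
  -- The thin direction: two points of the body differing by `t` in entry `(i, 0)` have first
  -- columns differing by `t e_i`, so `|t| L(e_i) ≤ 2/r`, while `L(e_i) ≥ D/n`.
  have hℓ : ∀ u ∈ {u : Mat n m | gradGauge Q p μ G u ≤ 1}, ∀ t : ℝ,
      u + t • EuclideanSpace.single ((i, ⟨0, hm⟩) : Fin n × Fin m) (1 : ℝ) ∈
        {u : Mat n m | gradGauge Q p μ G u ≤ 1} → |t| ≤ 2 * n / (r * D) := by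
    intro u hu t ht
    have h1 := hLg _ hu ⟨0, hm⟩
    have h2 := hLg _ ht ⟨0, hm⟩
    have hc : col (EuclideanSpace.single ((i, ⟨0, hm⟩) : Fin n × Fin m) (1 : ℝ) : Mat n m)
        ⟨0, hm⟩ = EuclideanSpace.single i (1 : ℝ) := by
      ext k
      simp [col]
    have h3 := hLsub (col (u + t • EuclideanSpace.single ((i, ⟨0, hm⟩) : Fin n × Fin m) (1 : ℝ))
      ⟨0, hm⟩) (col u ⟨0, hm⟩)
    rw [col_add, add_sub_cancel_left, col_smul, hc, hLsmul] at h3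
    rw [col_add, col_smul, hc] at h2
    rw [le_div_iff₀ (by positivity)]
    have h4 : r * (|t| * L (EuclideanSpace.single i 1)) ≤ 2 := by nlinarith
    have h5 : r * |t| * D ≤ r * |t| * (n * L (EuclideanSpace.single i 1)) := by gcongr
    nlinarith
  have h := volume_euclidean_le_of_slice hmeas hρ _ hℓ
  rw [Fintype.card_prod, Fintype.card_fin, Fintype.card_fin, ← ENNReal.ofReal_pow (by positivity),
    ← ENNReal.ofReal_mul (by positivity)] at h
  exact h

/-- The affine energy controls a geometric mean of the `L^p` norms of `f` and of its gradient. -/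
theorem le_affineEnergy (hn : 1 ≤ n) (hm : 1 ≤ m) (Q : ConvexBody (Euc m))
    {r : ℝ} (hr : 0 < r) (hrQ : ∀ y, r * ‖y‖ ≤ supportFun Q y) {p : ℝ} (hp : 1 ≤ p)
    {T : ℝ} (hT : 0 < T) : ∃ c : ℝ, 0 < c ∧ ∀ {μ : Measure (Euc n)} [SFinite μ]
    {G : Euc n → Euc n} {P D : ℝ}, AEStronglyMeasurable G μ → 0 < P → 0 < D →
    eLpNorm G (ENNReal.ofReal p) μ = ENNReal.ofReal D →
    (∀ v : Euc n, ‖v‖ = 1 → ENNReal.ofReal P ≤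
      ENNReal.ofReal T * eLpNorm (fun x => inner ℝ v (G x)) (ENNReal.ofReal p) μ) →
    normConst n Q p * ENNReal.ofReal (c * D ^ (1 / ((n : ℝ) * m)) * P ^ (1 - 1 / ((n : ℝ) * m))) ≤
      affineEnergy Q p μ G := by
  have hn0 : (0 : ℝ) < n := by exact_mod_cast hn
  have hm0 : (0 : ℝ) < m := by exact_mod_cast hm
  have hN1 : 1 ≤ n * m := Nat.mul_pos hn hm
  set N : ℝ := (n : ℝ) * m with hN
  have hN0 : 0 < N := by positivity
  -- `A` is `N` times the volume bound with its dependence on `D` and `P`, namely `D⁻¹ P^(1-N)`,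
  -- removed.
  set A : ℝ := N * (2 * n / r * (2 * T / r) ^ (n * m - 1)) with hA
  have hA0 : 0 < A := by positivity
  refine ⟨A ^ (-(1 / N)), by positivity, fun {μ} _ {G} {P D} hG hP hD hDG hPG => ?_⟩
  have hv := volume_gradGauge_le hn hm Q hr hrQ hp hG hP hD hT hDG hPG
  have hE : affineEnergy Q p μ G = normConst n Q p *
    (∫⁻ θ : Metric.sphere (0 : Mat n m) 1, gradGauge Q p μ G θ ^ (-N)
      ∂(volume : Measure (Mat n m)).toSphere) ^ (-(1 / N)) := rfl
  rw [hE, lintegral_sphere_gradGauge hn hm Q hp hG]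
  have hle : (n : ℝ≥0∞) * (m : ℝ≥0∞) * volume {u : Mat n m | gradGauge Q p μ G u ≤ 1} ≤
      ENNReal.ofReal (A * (D⁻¹ * P ^ (1 - N))) := by
    calc _ ≤ (n : ℝ≥0∞) * (m : ℝ≥0∞) *
          ENNReal.ofReal (2 * n / (r * D) * (2 * (T / (r * P))) ^ (n * m - 1)) := by gcongr
      _ = _ := by
        rw [← ENNReal.ofReal_natCast, ← ENNReal.ofReal_natCast,
          ← ENNReal.ofReal_mul (by positivity), ← ENNReal.ofReal_mul (by positivity)]
        congr 1
        have hPN : P ^ (1 - N) = (P ^ (n * m - 1))⁻¹ := by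
          rw [← Real.rpow_natCast, ← Real.rpow_neg hP.le, Nat.cast_sub hN1]
          push_cast
          rw [neg_sub]
        rw [hPN, hA, show 2 * (T / (r * P)) = (2 * T / r) * P⁻¹ by field_simp, mul_pow, inv_pow]
        field_simp
        rw [hN]
  clear_value A
  gcongr
  calc _ = ENNReal.ofReal (A * (D⁻¹ * P ^ (1 - N))) ^ (-(1 / N)) := by
        rw [ENNReal.ofReal_rpow_of_pos (by positivity)]
        congr 1
        rw [Real.mul_rpow hA0.le (by positivity), Real.mul_rpow (by positivity) (by positivity),
          ← Real.rpow_mul hP.le, Real.inv_rpow hD.le, ← Real.rpow_neg hD.le, neg_neg, mul_assoc]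
        congr 3
        field_simp
        ring
    _ ≤ _ := by
        rw [ENNReal.rpow_neg, ENNReal.rpow_neg]
        gcongr

end LowerBound

/-! ### Directional Poincaré inequality for Sobolev functions -/

section Poincare

open Set

variable {n : ℕ}

theorem inner_gradient (φ : Euc n → ℝ) (x v : Euc n) :
    inner ℝ v (gradient φ x) = fderiv ℝ φ x v := by
  rw [real_inner_comm, gradient, InnerProductSpace.toDual_symm_apply]

theorem continuous_inner_gradient {φ : Euc n → ℝ} (hφ : ContDiff ℝ ∞ φ) (v : Euc n) :
    Continuous fun x => inner ℝ v (gradient φ x) := by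
  simp_rw [inner_gradient]
  exact (hφ.continuous_fderiv (by simp)).clm_apply continuous_const

/-- Averaging along a segment is bounded in `L^p`. -/
theorem lintegral_segment_rpow_le {ψ : Euc n → ℝ} (hψ : Continuous ψ) {p : ℝ} (hp : 1 ≤ p) (T : ℝ)
    (v : Euc n) :
    ∫⁻ x, (∫⁻ t in Ioc 0 T, ‖ψ (x - t • v)‖ₑ) ^ p ≤
      ENNReal.ofReal T ^ p * ∫⁻ x, ‖ψ x‖ₑ ^ p := by
  have hp0 : 0 < p := by linarith
  have hm : Measurable fun z : Euc n × ℝ => ‖ψ (z.1 - z.2 • v)‖ₑ ^ p :=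
    (Continuous.measurable (by fun_prop : Continuous fun z : Euc n × ℝ =>
      ψ (z.1 - z.2 • v))).enorm.pow_const p
  -- Hölder on a segment costs `T^(p-1)`; translation invariance and integration over `t` supply the
  -- remaining factor `T`.
  have holder : ∀ x, (∫⁻ t in Ioc 0 T, ‖ψ (x - t • v)‖ₑ) ^ p ≤
      ENNReal.ofReal T ^ (p - 1) * ∫⁻ t in Ioc 0 T, ‖ψ (x - t • v)‖ₑ ^ p := fun x => by
    have h := eLpNorm_le_eLpNorm_mul_rpow_measure_univ (μ := volume.restrict (Ioc 0 T))
      (p := 1) (q := ENNReal.ofReal p) (f := fun t => ψ (x - t • v)) (by simpa using hp)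
      (by fun_prop : Continuous fun t : ℝ => ψ (x - t • v)).aestronglyMeasurable
    rw [eLpNorm_one_eq_lintegral_enorm, Measure.restrict_apply_univ, Real.volume_Ioc,
      ENNReal.toReal_ofReal hp0.le, ENNReal.toReal_one, sub_zero] at h
    refine (ENNReal.rpow_le_rpow h hp0.le).trans (le_of_eq ?_)
    rw [ENNReal.mul_rpow_of_nonneg _ _ hp0.le, eLpNorm_ofReal_rpow hp, ← ENNReal.rpow_mul, mul_comm]
    congr 2
    field_simp
  calc _ ≤ ∫⁻ x, ENNReal.ofReal T ^ (p - 1) * ∫⁻ t in Ioc 0 T, ‖ψ (x - t • v)‖ₑ ^ p :=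
        lintegral_mono holder
    _ = ENNReal.ofReal T ^ (p - 1) * ∫⁻ t in Ioc 0 T, ∫⁻ x, ‖ψ (x - t • v)‖ₑ ^ p := by
        rw [lintegral_const_mul _ hm.lintegral_prod_right',
          lintegral_lintegral_swap hm.aemeasurable]
    _ = ENNReal.ofReal T ^ (p - 1) * (ENNReal.ofReal T * ∫⁻ x, ‖ψ x‖ₑ ^ p) := by
        congr 1
        have : ∀ t : ℝ, ∫⁻ x, ‖ψ (x - t • v)‖ₑ ^ p = ∫⁻ x, ‖ψ x‖ₑ ^ p := fun t =>
          lintegral_sub_right_eq_self (fun x => ‖ψ x‖ₑ ^ p) (t • v)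
        simp_rw [this]
        rw [lintegral_const, Measure.restrict_apply_univ, Real.volume_Ioc, sub_zero, mul_comm]
    _ = _ := by
        rw [← mul_assoc]
        congr 1
        have h := ENNReal.rpow_add_of_nonneg (x := ENNReal.ofReal T) (p - 1) 1
          (by linarith) one_pos.le
        rw [sub_add_cancel, ENNReal.rpow_one] at h
        exact h.symm

/-- The Poincaré inequality in a direction for smooth functions supported in a ball. -/
theorem eLpNorm_le_eLpNorm_inner_gradient {φ : Euc n → ℝ} (hφ : ContDiff ℝ ∞ φ) {R : ℝ}
    (hsupp : ∀ x, R ≤ ‖x‖ → φ x = 0) {p : ℝ} (hp : 1 ≤ p) {v : Euc n} (hv : ‖v‖ = 1) :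
    eLpNorm φ (ENNReal.ofReal p) volume ≤ ENNReal.ofReal (2 * R) *
      eLpNorm (fun x => inner ℝ v (gradient φ x)) (ENNReal.ofReal p) volume := by
  have hp0 : 0 < p := by linarith
  set ψ : Euc n → ℝ := fun x => inner ℝ v (gradient φ x) with hψd
  have hψ : Continuous ψ := continuous_inner_gradient hφ v
  have hpt : ∀ x, ‖φ x‖ₑ ≤ ∫⁻ t in Ioc 0 (2 * R), ‖ψ (x - t • v)‖ₑ := fun x => by
    rcases le_or_gt R ‖x‖ with hx | hx
    · simp [hsupp x hx]
    have hR : 0 < R := (norm_nonneg x).trans_lt hx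
    have hd : ∀ t : ℝ, HasDerivAt (fun t : ℝ => φ (x - t • v)) (-ψ (x - t • v)) t := fun t => by
      have h1 : HasDerivAt (fun t : ℝ => x - t • v) (-v) t := by
        simpa using ((hasDerivAt_id t).smul_const v).const_sub x
      have h2 := (hφ.differentiable (by simp) (x - t • v)).hasFDerivAt.comp_hasDerivAt t h1
      rw [map_neg, ← inner_gradient] at h2
      exact h2
    have hc : Continuous fun t : ℝ => -ψ (x - t • v) := by fun_prop
    have hI := intervalIntegral.integral_eq_sub_of_hasDerivAt (a := 0) (b := 2 * R)
      (fun t _ => hd t) (hc.intervalIntegrable _ _)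
    -- A unit-speed segment of length `2R` starting in the ball of radius `R` ends outside it, where
    -- `φ` vanishes.
    have hz : φ (x - (2 * R) • v) = 0 := by
      apply hsupp
      have h3 := norm_sub_norm_le ((2 * R) • v) x
      rw [norm_smul, hv, Real.norm_of_nonneg (by positivity), norm_sub_rev] at h3
      linarith
    rw [hz, zero_smul, sub_zero, zero_sub, intervalIntegral.integral_neg, neg_inj,
      intervalIntegral.integral_of_le (by positivity)] at hI
    rw [← hI]
    exact enorm_integral_le_lintegral_enorm _
  rw [← ENNReal.rpow_le_rpow_iff hp0, ENNReal.mul_rpow_of_nonneg _ _ hp0.le,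
    eLpNorm_ofReal_rpow hp, eLpNorm_ofReal_rpow hp]
  refine le_trans (lintegral_mono fun x => ?_) (lintegral_segment_rpow_le hψ hp (2 * R) v)
  exact ENNReal.rpow_le_rpow (hpt x) hp0.le

/-- The constant `2R` is the same for all test functions supported in `Ω`, so the inequality
survives the limit. -/
theorem IsSobolevZero.eLpNorm_le_inner {p : ℝ} (hp : 1 ≤ p) {Ω : Set (Euc n)} {R : ℝ}
    (hR : ∀ x ∈ Ω, ‖x‖ < R) {f : Euc n → ℝ} {G : Euc n → Euc n} (h : IsSobolevZero p Ω f G)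
    {v : Euc n} (hv : ‖v‖ = 1) :
    eLpNorm f (ENNReal.ofReal p) volume ≤ ENNReal.ofReal (2 * R) *
      eLpNorm (fun x => inner ℝ v (G x)) (ENNReal.ofReal p) volume := by
  obtain ⟨hf, hG, φ, hφ, hf', hG'⟩ := h
  have hp' : 1 ≤ ENNReal.ofReal p := by simpa using hp
  have hgc : ∀ k, Continuous (gradient (φ k)) := fun k =>
    (InnerProductSpace.toDual ℝ (Euc n)).symm.continuous.comp
      ((hφ k).1.continuous_fderiv (by simp))
  have hbound : ∀ k, eLpNorm f (ENNReal.ofReal p) volume ≤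
      eLpNorm (fun x => φ k x - f x) (ENNReal.ofReal p) volume + ENNReal.ofReal (2 * R) *
        (eLpNorm (fun x => gradient (φ k) x - G x) (ENNReal.ofReal p) volume +
          eLpNorm (fun x => inner ℝ v (G x)) (ENNReal.ofReal p) volume) := fun k => by
    have hφm : AEStronglyMeasurable (φ k) volume := (hφ k).1.continuous.aestronglyMeasurable
    have h1 : eLpNorm f (ENNReal.ofReal p) volume ≤
        eLpNorm (fun x => φ k x - f x) (ENNReal.ofReal p) volume +
          eLpNorm (φ k) (ENNReal.ofReal p) volume := by
      rw [add_comm]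
      have := eLpNorm_sub_le hφm (hφm.sub hf.aestronglyMeasurable) hp'
      rwa [sub_sub_cancel] at this
    have h2 := eLpNorm_le_eLpNorm_inner_gradient (hφ k).1 (R := R) (fun x hx => by
      by_contra h0
      exact (hR x ((hφ k).2.2 (subset_tsupport _ h0))).not_ge hx) hp hv
    have h3 : eLpNorm (fun x => inner ℝ v (gradient (φ k) x)) (ENNReal.ofReal p) volume ≤
        eLpNorm (fun x => gradient (φ k) x - G x) (ENNReal.ofReal p) volume +
          eLpNorm (fun x => inner ℝ v (G x)) (ENNReal.ofReal p) volume := by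
      have h4 : (fun x => inner ℝ v (gradient (φ k) x)) =
          (fun x => inner ℝ v (gradient (φ k) x - G x)) + fun x => inner ℝ v (G x) := by
        ext x; simp [inner_sub_right]
      rw [h4]
      refine (eLpNorm_add_le (aestronglyMeasurable_const.inner
        ((hgc k).aestronglyMeasurable.sub hG.aestronglyMeasurable))
        (aestronglyMeasurable_const.inner hG.aestronglyMeasurable) hp').trans ?_
      gcongr
      have := eLpNorm_inner_le (μ := volume) (G := fun x => gradient (φ k) x - G x)
        (ENNReal.ofReal p) v
      rwa [hv, ENNReal.ofReal_one, one_mul] at this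
    exact h1.trans (by gcongr; exact h2.trans (by gcongr))
  have hlim : Tendsto (fun k => eLpNorm (fun x => φ k x - f x) (ENNReal.ofReal p) volume +
      ENNReal.ofReal (2 * R) *
        (eLpNorm (fun x => gradient (φ k) x - G x) (ENNReal.ofReal p) volume +
          eLpNorm (fun x => inner ℝ v (G x)) (ENNReal.ofReal p) volume)) atTop
      (𝓝 (0 + ENNReal.ofReal (2 * R) *
        (0 + eLpNorm (fun x => inner ℝ v (G x)) (ENNReal.ofReal p) volume))) :=
    hf'.add (ENNReal.Tendsto.const_mul (hG'.add tendsto_const_nhds) (Or.inr ENNReal.ofReal_ne_top))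
  rw [zero_add, zero_add] at hlim
  exact ge_of_tendsto' hlim hbound

theorem IsSobolevZero.ae_eq_zero {p : ℝ} (hp : 1 ≤ p) {Ω : Set (Euc n)} (hΩ : IsOpen Ω)
    {f : Euc n → ℝ} {G : Euc n → Euc n} (h : IsSobolevZero p Ω f G) :
    ∀ᵐ x ∂(volume : Measure (Euc n)), x ∉ Ω → f x = 0 := by
  obtain ⟨hf, hG, φ, hφ, hf', hG'⟩ := h
  have hp0 : ENNReal.ofReal p ≠ 0 := by simp; linarith
  have h0 : eLpNorm f (ENNReal.ofReal p) (volume.restrict Ωᶜ) = 0 := by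
    refine le_antisymm (ge_of_tendsto' hf' fun k => ?_) zero_le
    calc eLpNorm f (ENNReal.ofReal p) (volume.restrict Ωᶜ)
        = eLpNorm (fun x => φ k x - f x) (ENNReal.ofReal p) (volume.restrict Ωᶜ) := by
          rw [← eLpNorm_neg]
          refine eLpNorm_congr_ae ?_
          filter_upwards [ae_restrict_mem hΩ.measurableSet.compl] with x hx
          have : φ k x = 0 := by
            by_contra h0
            exact hx ((hφ k).2.2 (subset_tsupport _ h0))
          simp [this]
      _ ≤ _ := eLpNorm_restrict_le _ _ _ _
  rw [eLpNorm_eq_zero_iff hf.aestronglyMeasurable.restrict hp0] at h0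
  exact (ae_restrict_iff' hΩ.measurableSet.compl).1 h0

end Poincare

/-! ### Directional Poincaré inequality for functions of bounded variation -/

section BoundedVariation

open Set

variable {n : ℕ}

/-- The integral of a function along segments of direction `v` and length `T`. -/
def segmentIntegral (ψ : Euc n → ℝ) (T : ℝ) (v : Euc n) (x : Euc n) : ℝ :=
  ∫ t in Ioc 0 T, ψ (x - t • v)

/-- The segment integral is the convolution of `ψ` with the image of Lebesgue measure on `(0, T]`
under `t ↦ t v`, so it inherits smoothness. -/
theorem contDiff_segmentIntegral {ψ : Euc n → ℝ} (hψ : ContDiff ℝ ∞ ψ) (hc : HasCompactSupport ψ)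
    (T : ℝ) (v : Euc n) : ContDiff ℝ ∞ (segmentIntegral ψ T v) := by
  set ν : Measure (Euc n) := (volume.restrict (Ioc 0 T)).map fun t : ℝ => t • v
  have hv : Measurable fun t : ℝ => t • v := by fun_prop
  have hconv : segmentIntegral ψ T v =
      (convolution (fun _ : Euc n => (1 : ℝ)) ψ (ContinuousLinearMap.lsmul ℝ ℝ) ν) := by
    ext x
    rw [convolution_lsmul, integral_map hv.aemeasurable]
    · simp [segmentIntegral]
    · have := hψ.continuous
      exact Continuous.aestronglyMeasurable (by fun_prop)
  rw [hconv]
  exact hc.contDiff_convolution_right _ (locallyIntegrable_const 1) hψ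

theorem fderiv_segmentIntegral {ψ : Euc n → ℝ} (hψ : ContDiff ℝ ∞ ψ) (hc : HasCompactSupport ψ)
    {T : ℝ} (hT : 0 ≤ T) (v x : Euc n) :
    fderiv ℝ (segmentIntegral ψ T v) x v = ψ x - ψ (x - T • v) := by
  have hψc := hψ.continuous
  have hcont : Continuous fun t : ℝ => ψ (x + t • v) := by fun_prop
  -- Along the line through `x` the segment integral is a difference of two values of one primitive,
  -- so its derivative is a boundary difference.
  have heq : ∀ s : ℝ, segmentIntegral ψ T v (x + s • v) =
      (∫ t in (0 : ℝ)..s, ψ (x + t • v)) - ∫ t in (0 : ℝ)..(s - T), ψ (x + t • v) := fun s => by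
    rw [segmentIntegral, ← intervalIntegral.integral_of_le hT,
      intervalIntegral.integral_interval_sub_left (hcont.intervalIntegrable _ _)
        (hcont.intervalIntegrable _ _)]
    have := intervalIntegral.integral_comp_sub_left (fun t => ψ (x + t • v)) s (a := 0) (b := T)
    rw [sub_zero] at this
    rw [← this]
    refine intervalIntegral.integral_congr fun t _ => ?_
    simp only [sub_smul]
    congr 1
    abel
  have h1 : HasDerivAt (fun s : ℝ => ∫ t in (0 : ℝ)..s, ψ (x + t • v)) (ψ (x + (0 : ℝ) • v)) 0 :=
    hcont.integral_hasStrictDerivAt 0 0 |>.hasDerivAt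
  have h2 : HasDerivAt (fun s : ℝ => ∫ t in (0 : ℝ)..(s - T), ψ (x + t • v))
      (ψ (x + (0 - T) • v)) 0 :=
    HasDerivAt.comp_sub_const 0 T (hcont.integral_hasStrictDerivAt 0 (0 - T) |>.hasDerivAt)
  have h3 : HasDerivAt (fun s : ℝ => segmentIntegral ψ T v (x + s • v))
      (ψ x - ψ (x - T • v)) 0 := by
    have h := h1.sub h2
    rw [zero_smul, add_zero, zero_sub, neg_smul, ← sub_eq_add_neg] at h
    refine h.congr_of_eventuallyEq (.of_forall fun s => heq s)
  have h4 : HasDerivAt (fun s : ℝ => segmentIntegral ψ T v (x + s • v))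
      (fderiv ℝ (segmentIntegral ψ T v) x v) 0 := by
    have hd : HasDerivAt (fun s : ℝ => x + s • v) v 0 := by
      simpa using ((hasDerivAt_id (0 : ℝ)).smul_const v).const_add x
    have hf : HasFDerivAt (segmentIntegral ψ T v) (fderiv ℝ (segmentIntegral ψ T v) x)
        (x + (0 : ℝ) • v) := by
      rw [zero_smul, add_zero]
      exact ((contDiff_segmentIntegral hψ hc T v).differentiable (by simp) x).hasFDerivAt
    exact hf.comp_hasDerivAt 0 hd
  exact h4.unique h3

theorem hasCompactSupport_segmentIntegral {ψ : Euc n → ℝ} {R : ℝ} (hψ : ∀ x, R ≤ ‖x‖ → ψ x = 0)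
    (T : ℝ) {v : Euc n} (hv : ‖v‖ = 1) : HasCompactSupport (segmentIntegral ψ T v) := by
  refine HasCompactSupport.intro (isCompact_closedBall (0 : Euc n) (R + T)) fun x hx => ?_
  rw [mem_closedBall_zero_iff, not_le] at hx
  refine setIntegral_eq_zero_of_forall_eq_zero fun t ht => hψ _ ?_
  have h := norm_sub_norm_le x (t • v)
  rw [norm_smul, hv, Real.norm_of_nonneg ht.1.le] at h
  linarith [ht.2]

theorem abs_segmentIntegral_le {ψ : Euc n → ℝ} (hψ : ∀ x, |ψ x| ≤ 1) {T : ℝ} (hT : 0 ≤ T)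
    (v x : Euc n) : |segmentIntegral ψ T v x| ≤ T := by
  have := norm_setIntegral_le_of_norm_le_const (μ := volume) (s := Ioc 0 T) (C := 1)
    (f := fun t => ψ (x - t • v)) (by simp) (fun t _ => hψ _)
  simpa [segmentIntegral, hT] using this

/-- Dual form of the Poincaré inequality: the test function is the segment integral of `ψ`. It is
bounded by `T`, and its `v`-derivative is `ψ` on `Ω`. -/
theorem IsBVZero.integral_mul_le {Ω : Set (Euc n)} {R : ℝ} (hR0 : 0 ≤ R)
    (hR : ∀ x ∈ Ω, ‖x‖ < R) {f : Euc n → ℝ} {μ : Measure (Euc n)} {η : Euc n → Euc n}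
    (h : IsBVZero Ω f μ η) {v : Euc n} (hv : ‖v‖ = 1) {ψ : Euc n → ℝ} (hψ : ContDiff ℝ ∞ ψ)
    (hψ1 : ∀ x, |ψ x| ≤ 1) (hψR : ∀ x, R + 1 ≤ ‖x‖ → ψ x = 0) :
    ∫ x, f x * ψ x ≤ (2 * R + 1) * ∫ x, |inner ℝ v (η x)| ∂μ := by
  obtain ⟨hf, hf0, hμ, hη, hη1, hibp⟩ := h
  -- For `x ∈ Ω` this length gives `‖x - T v‖ ≥ R + 1`, beyond the region where `ψ` may be nonzero.
  set T := 2 * R + 1 with hTd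
  have hT : 0 ≤ T := by positivity
  have hc : HasCompactSupport ψ :=
    HasCompactSupport.intro (isCompact_closedBall (0 : Euc n) (R + 1)) fun x hx => by
      rw [mem_closedBall_zero_iff, not_le] at hx
      exact hψR x hx.le
  have h1 := hibp _ (contDiff_segmentIntegral hψ hc T v)
    (hasCompactSupport_segmentIntegral hψR T hv) v
  have h2 : ∫ x, f x * fderiv ℝ (segmentIntegral ψ T v) x v = ∫ x, f x * ψ x := by
    refine integral_congr_ae ?_
    filter_upwards [hf0] with x hx
    by_cases hxΩ : x ∈ Ω
    · rw [fderiv_segmentIntegral hψ hc hT, hψR (x - T • v), sub_zero]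
      have h3 := norm_sub_norm_le (T • v) x
      rw [norm_smul, hv, Real.norm_of_nonneg hT, norm_sub_rev] at h3
      linarith [hR x hxΩ]
    · rw [hx hxΩ, zero_mul, zero_mul]
  have hint : Integrable (fun x => |inner ℝ v (η x)|) μ := by
    refine Integrable.mono' (integrable_const (1 : ℝ)) (by fun_prop) ?_
    filter_upwards [hη1] with x hx
    rw [norm_abs_eq_norm]
    refine (norm_inner_le_norm _ _).trans ?_
    rw [hv, hx, one_mul]
  rw [← h2, h1, ← integral_const_mul]
  refine (neg_le_abs _).trans ?_
  rw [← Real.norm_eq_abs]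
  refine norm_integral_le_of_norm_le (hint.const_mul T) (.of_forall fun x => ?_)
  rw [norm_mul, real_inner_comm, Real.norm_eq_abs, Real.norm_eq_abs]
  gcongr
  exact abs_segmentIntegral_le hψ1 hT v x

theorem abs_sub_le_mul_div_sqrt {δ : ℝ} (hδ : 0 < δ) (y : ℝ) :
    |y| - δ ≤ y * (y / √(y ^ 2 + δ ^ 2)) := by
  have hs : 0 < √(y ^ 2 + δ ^ 2) := Real.sqrt_pos.2 (by positivity)
  have hle : √(y ^ 2 + δ ^ 2) ≤ |y| + δ := by
    rw [Real.sqrt_le_left (by positivity), ← sq_abs y]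
    nlinarith [abs_nonneg y]
  rw [← mul_div_assoc, le_div_iff₀ hs]
  rcases le_or_gt |y| δ with h | h
  · have : (|y| - δ) * √(y ^ 2 + δ ^ 2) ≤ 0 := mul_nonpos_of_nonpos_of_nonneg (by linarith) hs.le
    nlinarith
  · have : (|y| - δ) * √(y ^ 2 + δ ^ 2) ≤ (|y| - δ) * (|y| + δ) := by gcongr
    nlinarith [abs_mul_abs_self y]

/-- The sign of an integrable function is weakly approximated by smooth functions. -/
theorem exists_contDiff_mul_ge {f : Euc n → ℝ} (hf : Integrable f volume) {R : ℝ}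
    (hR : 0 < R) (hf0 : ∀ᵐ x ∂(volume : Measure (Euc n)), R ≤ ‖x‖ → f x = 0) {ε : ℝ} (hε : 0 < ε) :
    ∃ ψ : Euc n → ℝ, ContDiff ℝ ∞ ψ ∧ (∀ x, |ψ x| ≤ 1) ∧ (∀ x, R + 1 ≤ ‖x‖ → ψ x = 0) ∧
      ∫ x, |f x| ≤ (∫ x, f x * ψ x) + ε := by
  obtain ⟨g, hgc, hg, hfg⟩ := (memLp_one_iff_integrable.2 hf).exist_eLpNorm_sub_le
    ENNReal.one_ne_top le_rfl (ε := ε / 4) (by positivity)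
  have hgi : Integrable g volume := hg.continuous.integrable_of_hasCompactSupport hgc
  -- The approximant `g` need not vanish off the ball; the cutoff localizes it without increasing
  -- the error, since `f` vanishes where `χ` may differ from `1`.
  let χ : ContDiffBump (0 : Euc n) := ⟨R, R + 1, hR, by linarith⟩
  set B : Set (Euc n) := Metric.ball 0 (R + 1)
  set V : ℝ := (volume B).toReal
  have hV : 0 ≤ V := ENNReal.toReal_nonneg
  -- The smoothed sign `k / √(k² + δ²)` loses at most `δ` pointwise on `B`, hence at most `ε/2` in
  -- total. Passing from `f` to `k` and back costs `2 · ε/4`.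
  set δ : ℝ := ε / (2 * (V + 1)) with hδd
  have hδ : 0 < δ := by positivity
  set k : Euc n → ℝ := fun x => χ x * g x with hk
  have hkd : ContDiff ℝ ∞ k := χ.contDiff.mul hg
  have hk0 : ∀ x, R + 1 ≤ ‖x‖ → k x = 0 := fun x hx => by
    simp only [hk]
    rw [χ.zero_of_le_dist (by simpa using hx), zero_mul]
  have hsq : ∀ x, 0 < √(k x ^ 2 + δ ^ 2) := fun x => Real.sqrt_pos.2 (by positivity)
  have hψd : ContDiff ℝ ∞ fun x => k x / √(k x ^ 2 + δ ^ 2) :=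
    hkd.div (((hkd.pow 2).add contDiff_const).sqrt fun x => by positivity) fun x => (hsq x).ne'
  have hψ1 : ∀ x, |k x / √(k x ^ 2 + δ ^ 2)| ≤ 1 := fun x => by
    rw [abs_div, abs_of_pos (hsq x), div_le_one (hsq x)]
    exact Real.abs_le_sqrt (by nlinarith)
  refine ⟨fun x => k x / √(k x ^ 2 + δ ^ 2), hψd, hψ1, fun x hx => by simp [hk0 x hx], ?_⟩
  have hpt : ∀ᵐ x ∂(volume : Measure (Euc n)), |f x| ≤ f x * (k x / √(k x ^ 2 + δ ^ 2)) +
      (2 * |f x - g x| + B.indicator (fun _ => δ) x) := by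
    filter_upwards [hf0] with x hx
    have h1 : |f x - k x| ≤ |f x - g x| := by
      rcases le_or_gt R ‖x‖ with h | h
      · rw [hx h, zero_sub, zero_sub, abs_neg, abs_neg]
        simp only [hk]
        rw [abs_mul, abs_of_nonneg χ.nonneg]
        exact mul_le_of_le_one_left (abs_nonneg _) χ.le_one
      · simp only [hk]
        rw [χ.one_of_mem_closedBall (by simpa using h.le), one_mul]
    have h2 : |k x| ≤ k x * (k x / √(k x ^ 2 + δ ^ 2)) + B.indicator (fun _ => δ) x := by
      by_cases hxB : x ∈ B
      · rw [indicator_of_mem hxB]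
        linarith [abs_sub_le_mul_div_sqrt hδ (k x)]
      · have : k x = 0 := hk0 x (by simpa [B] using hxB)
        simp [this, indicator_of_notMem hxB]
    have h3 : (k x - f x) * (k x / √(k x ^ 2 + δ ^ 2)) ≤ |f x - k x| := by
      refine (le_abs_self _).trans ?_
      rw [abs_mul, abs_sub_comm]
      exact mul_le_of_le_one_right (abs_nonneg _) (hψ1 x)
    have h4 : |f x| ≤ |k x| + |f x - k x| := by
      have := abs_add_le (k x) (f x - k x)
      rwa [add_sub_cancel] at this
    linarith
  have hi1 : Integrable (fun x => f x * (k x / √(k x ^ 2 + δ ^ 2))) volume :=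
    hf.mul_bdd (c := 1) hψd.continuous.aestronglyMeasurable (.of_forall fun x => hψ1 x)
  have hi2 : Integrable (fun x => 2 * |f x - g x|) volume := ((hf.sub hgi).abs).const_mul 2
  have hi3 : Integrable (B.indicator fun _ => δ) volume :=
    (integrable_indicator_iff measurableSet_ball).2
      (integrableOn_const measure_ball_lt_top.ne)
  have h1 := integral_mono_ae hf.abs (hi1.add (hi2.add hi3)) hpt
  have h2 : ∫ x, |f x - g x| ≤ ε / 4 := by
    have h := ENNReal.toReal_mono ENNReal.ofReal_ne_top hfg
    rw [ENNReal.toReal_ofReal (by positivity), eLpNorm_one_eq_lintegral_enorm,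
      ← integral_norm_eq_lintegral_enorm (hf.sub hgi).aestronglyMeasurable] at h
    exact h
  have h3 : ∫ x, B.indicator (fun _ => δ) x ≤ ε / 2 := by
    rw [integral_indicator_const _ measurableSet_ball, smul_eq_mul]
    change V * δ ≤ ε / 2
    rw [hδd, mul_div_assoc', div_le_div_iff₀ (by positivity) (by positivity)]
    nlinarith
  have h4 : ∫ x, (f x * (k x / √(k x ^ 2 + δ ^ 2)) +
      (2 * |f x - g x| + B.indicator (fun _ => δ) x)) =
      (∫ x, f x * (k x / √(k x ^ 2 + δ ^ 2))) +
        (2 * (∫ x, |f x - g x|) + ∫ x, B.indicator (fun _ => δ) x) := by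
    have hi4 : Integrable (fun x => 2 * |f x - g x| + B.indicator (fun _ => δ) x) volume :=
      hi2.add hi3
    rw [integral_add hi1 hi4, integral_add hi2 hi3, integral_const_mul]
  have h5 := h1.trans h4.le
  linarith

theorem IsBVZero.eLpNorm_le_inner {Ω : Set (Euc n)} {R : ℝ} (hR0 : 0 < R)
    (hR : ∀ x ∈ Ω, ‖x‖ < R) {f : Euc n → ℝ} {μ : Measure (Euc n)} {η : Euc n → Euc n}
    (h : IsBVZero Ω f μ η) {v : Euc n} (hv : ‖v‖ = 1) :
    eLpNorm f 1 volume ≤ ENNReal.ofReal (2 * R + 1) *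
      eLpNorm (fun x => inner ℝ v (η x)) 1 μ := by
  obtain ⟨hf, hf0, hμ, hη, hη1, hibp⟩ := id h
  have hint : Integrable (fun x => inner ℝ v (η x)) μ := by
    refine Integrable.mono' (integrable_const (1 : ℝ)) (by fun_prop) ?_
    filter_upwards [hη1] with x hx
    refine (norm_inner_le_norm _ _).trans ?_
    rw [hv, hx, one_mul]
  have hfR : ∀ᵐ x ∂(volume : Measure (Euc n)), R ≤ ‖x‖ → f x = 0 := by
    filter_upwards [hf0] with x hx hxR
    exact hx fun hxΩ => (hR x hxΩ).not_ge hxR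
  have key : ∫ x, |f x| ≤ (2 * R + 1) * ∫ x, |inner ℝ v (η x)| ∂μ := by
    refine le_of_forall_pos_le_add fun ε hε => ?_
    obtain ⟨ψ, hψ, hψ1, hψR, hle⟩ := exists_contDiff_mul_ge hf hR0 hfR hε
    linarith [h.integral_mul_le hR0.le hR hv hψ hψ1 hψR]
  rw [eLpNorm_one_eq_lintegral_enorm, eLpNorm_one_eq_lintegral_enorm,
    ← ofReal_integral_norm_eq_lintegral_enorm hf, ← ofReal_integral_norm_eq_lintegral_enorm hint,
    ← ENNReal.ofReal_mul (by positivity)]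
  exact ENNReal.ofReal_le_ofReal key

end BoundedVariation

/-! ### Comparison of the Rayleigh quotients of one competitor -/

section Eigenvalue

variable {n m : ℕ}

/-- The properties of a competitor `f` with gradient `(μ, G)` that enter the comparison of
energies, with a Poincaré inequality in every direction with constant `T`. -/
structure IsPoincarePair (p : ℝ) (Ω : Set (Euc n)) (T : ℝ) (f : Euc n → ℝ) (μ : Measure (Euc n))
    (G : Euc n → Euc n) : Prop where
  sfinite : SFinite μ
  memLp : MemLp f (ENNReal.ofReal p) volume
  memLp_gradient : MemLp G (ENNReal.ofReal p) μ
  ne_zero : ¬ f =ᵐ[volume] 0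
  eq_zero : ∀ᵐ x ∂(volume : Measure (Euc n)), x ∉ Ω → f x = 0
  poincare : ∀ v : Euc n, ‖v‖ = 1 → eLpNorm f (ENNReal.ofReal p) volume ≤
    ENNReal.ofReal T * eLpNorm (fun x => inner ℝ v (G x)) (ENNReal.ofReal p) μ

theorem exists_isPoincarePair {Ω : Set (Euc n)} (hΩ : IsOpen Ω) (hΩb : Bornology.IsBounded Ω)
    {p : ℝ} (hp : 1 ≤ p) :
    ∃ T : ℝ, 0 < T ∧ ∀ {f μ G}, IsCompetitor p Ω f μ G → IsPoincarePair p Ω T f μ G := by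
  obtain ⟨R, hR, hΩR⟩ : ∃ R : ℝ, 0 < R ∧ ∀ x ∈ Ω, ‖x‖ < R := by
    obtain ⟨R, hR, h⟩ := hΩb.exists_pos_norm_lt
    exact ⟨R, hR, h⟩
  -- The bounded variation case needs `2R + 1`; in the Sobolev case `2R` already suffices.
  refine ⟨2 * R + 1, by positivity, fun {f μ G} h => ?_⟩
  obtain ⟨h1, h2, h3⟩ := h
  rcases eq_or_ne p 1 with rfl | hp1
  · have h := h2 rfl
    have hpo := fun v hv => h.eLpNorm_le_inner hR hΩR (v := v) hv
    obtain ⟨hf, hf0, hμ, hη, hη1, -⟩ := h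
    refine ⟨inferInstance, ?_, ?_, h3, hf0, fun v hv => ?_⟩
    · rwa [ENNReal.ofReal_one, memLp_one_iff_integrable]
    · exact MemLp.of_bound hη.aestronglyMeasurable 1 (hη1.mono fun x hx => hx.le)
    · rw [ENNReal.ofReal_one]
      exact hpo v hv
  · obtain ⟨rfl, h⟩ := h1 hp1
    refine ⟨inferInstance, h.1, h.2.1, h3, h.ae_eq_zero hp hΩ, fun v hv => ?_⟩
    refine (h.eLpNorm_le_inner hp hΩR hv).trans ?_
    gcongr
    linarith

theorem IsPoincarePair.eLpNorm_restrict_ne_zero {p : ℝ} {Ω : Set (Euc n)} {T : ℝ} {f : Euc n → ℝ}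
    {μ : Measure (Euc n)} {G : Euc n → Euc n} (h : IsPoincarePair p Ω T f μ G)
    (hΩ : IsOpen Ω) {q : ℝ≥0∞} (hq : q ≠ 0) : eLpNorm f q (volume.restrict Ω) ≠ 0 := by
  rw [Ne, eLpNorm_eq_zero_iff h.memLp.aestronglyMeasurable.restrict hq]
  intro h0
  refine h.ne_zero ?_
  filter_upwards [(ae_restrict_iff' hΩ.measurableSet).1 h0, h.eq_zero] with x hx hx'
  by_cases hxΩ : x ∈ Ω
  · exact hx hxΩ
  · exact hx' hxΩ

theorem IsPoincarePair.eLpNorm_gradient_ne_zero (hn : 1 ≤ n) {p : ℝ} (hp : 1 ≤ p)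
    {Ω : Set (Euc n)} {T : ℝ} {f : Euc n → ℝ} {μ : Measure (Euc n)} {G : Euc n → Euc n}
    (h : IsPoincarePair p Ω T f μ G) : eLpNorm G (ENNReal.ofReal p) μ ≠ 0 := by
  intro h0
  have hv : ‖EuclideanSpace.single (⟨0, hn⟩ : Fin n) (1 : ℝ)‖ = 1 := by simp
  have h1 := (h.poincare _ hv).trans (mul_le_mul_right (eLpNorm_inner_le _ _) _)
  rw [h0, mul_zero, mul_zero, nonpos_iff_eq_zero,
    eLpNorm_eq_zero_iff h.memLp.aestronglyMeasurable (by simp; linarith)] at h1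
  exact h.ne_zero h1

theorem IsPoincarePair.affineEnergy_le (hn : 1 ≤ n) (hm : 1 ≤ m) (Q : ConvexBody (Euc m))
    (hQ : (0 : Euc m) ∈ interior (Q : Set (Euc m))) {p : ℝ} (hp : 1 ≤ p)
    {Ω : Set (Euc n)} {T : ℝ} {f : Euc n → ℝ} {μ : Measure (Euc n)} {G : Euc n → Euc n}
    (h : IsPoincarePair p Ω T f μ G) : affineEnergy Q p μ G ≤ eLpNorm G (ENNReal.ofReal p) μ :=
  have := h.sfinite
  AffineEigenvalue.affineEnergy_le hn hm Q hQ hp h.memLp_gradient.aestronglyMeasurable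
    (h.eLpNorm_gradient_ne_zero hn hp) h.memLp_gradient.eLpNorm_ne_top

/-- With `s = 1/(nm)`, this splits `A = A^s A^(1-s)` and absorbs `(P/A)^(1-s) ≥ C^(-(1-s))` into the
constant, leaving a power of the Rayleigh quotient `D/A`. -/
theorem rpow_div_le_of_le_mul {c C A P D s : ℝ} (hc : 0 < c) (hC : 0 < C) (hA : 0 < A)
    (hP : 0 < P) (hD : 0 < D) (hs : s ≤ 1) (h : A ≤ C * P) :
    c * C ^ (-(1 - s)) * (D / A) ^ s ≤ c * D ^ s * P ^ (1 - s) / A := by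
  have h1 : A ^ (1 - s) ≤ C ^ (1 - s) * P ^ (1 - s) := by
    rw [← Real.mul_rpow hC.le hP.le]
    exact Real.rpow_le_rpow hA.le h (by linarith)
  have hCs : 0 < C ^ (1 - s) := by positivity
  have hAs : 0 < A ^ s := by positivity
  rw [Real.rpow_sub hA, Real.rpow_one] at h1
  rw [Real.rpow_neg hC.le, Real.div_rpow hD.le hA.le]
  have h2 : A ≤ C ^ (1 - s) * P ^ (1 - s) * A ^ s := by
    rwa [div_le_iff₀ hAs] at h1
  rw [le_div_iff₀ hA]
  calc c * (C ^ (1 - s))⁻¹ * (D ^ s / A ^ s) * A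
      ≤ c * (C ^ (1 - s))⁻¹ * (D ^ s / A ^ s) * (C ^ (1 - s) * P ^ (1 - s) * A ^ s) := by gcongr
    _ = c * D ^ s * P ^ (1 - s) := by field_simp

theorem exists_mul_rpow_le_affineEnergy_div (hn : 1 ≤ n) (hm : 1 ≤ m) (Q : ConvexBody (Euc m))
    (hQ : (0 : Euc m) ∈ interior (Q : Set (Euc m))) {Ω : Set (Euc n)} (hΩ : IsOpen Ω)
    (hΩb : Bornology.IsBounded Ω) {p q : ℝ} (hq : 1 ≤ q) (hqp : q ≤ p) {T : ℝ} (hT : 0 < T) :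
    ∃ d : ℝ≥0, 0 < d ∧ ∀ {f μ G}, IsPoincarePair p Ω T f μ G →
      (d : ℝ≥0∞) * (eLpNorm G (ENNReal.ofReal p) μ /
        eLpNorm f (ENNReal.ofReal q) (volume.restrict Ω)) ^ (1 / ((n : ℝ) * (m : ℝ))) ≤
      affineEnergy Q p μ G / eLpNorm f (ENNReal.ofReal q) (volume.restrict Ω) := by
  have hp : 1 ≤ p := hq.trans hqp
  obtain ⟨r, hr, hrQ⟩ := exists_le_supportFun Q hQ
  obtain ⟨c, hc, hE⟩ := le_affineEnergy hn hm Q hr hrQ hp hT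
  have hnc0 := normConst_ne_zero hn hm Q hQ hp
  have hncT := normConst_ne_top hn hm Q hQ hp
  have hn1 : (1 : ℝ) ≤ n := by exact_mod_cast hn
  have hm1 : (1 : ℝ) ≤ m := by exact_mod_cast hm
  set s : ℝ := 1 / ((n : ℝ) * m) with hs
  have hs0 : 0 < s := by positivity
  have hs1 : s ≤ 1 := by
    rw [hs, div_le_one (by positivity)]
    nlinarith
  set w : ℝ := 1 / q - 1 / p with hw
  have hw0 : 0 ≤ w := by
    rw [hw, sub_nonneg]
    exact one_div_le_one_div_of_le (by linarith) hqp
  -- Hölder on `Ω` gives `‖f‖_q ≤ |Ω|^(1/q-1/p) ‖f‖_p`; the added `1` makes `C` positive without a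
  -- case distinction.
  set C : ℝ := (volume Ω ^ w).toReal + 1 with hC
  have hC0 : 0 < C := by positivity
  have hΩT : volume Ω ^ w ≠ ⊤ := ENNReal.rpow_ne_top_of_nonneg hw0 hΩb.measure_lt_top.ne
  set k : ℝ := c * C ^ (-(1 - s)) with hk
  have hk0 : 0 < k := by positivity
  refine ⟨(normConst n Q p * ENNReal.ofReal k).toNNReal, ?_, fun {f μ G} h => ?_⟩
  · refine ENNReal.toNNReal_pos (mul_ne_zero hnc0 (by simpa using hk0))
      (ENNReal.mul_ne_top hncT ENNReal.ofReal_ne_top)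
  rw [ENNReal.coe_toNNReal (ENNReal.mul_ne_top hncT ENNReal.ofReal_ne_top)]
  have := h.sfinite
  have hD0 := h.eLpNorm_gradient_ne_zero hn hp
  have hDT := h.memLp_gradient.eLpNorm_ne_top
  have hA0 := h.eLpNorm_restrict_ne_zero hΩ (q := ENNReal.ofReal q) (by simp; linarith)
  have hPT := h.memLp.eLpNorm_ne_top
  have hAP : eLpNorm f (ENNReal.ofReal q) (volume.restrict Ω) ≤
      ENNReal.ofReal C * eLpNorm f (ENNReal.ofReal p) volume := by
    have h1 := eLpNorm_le_eLpNorm_mul_rpow_measure_univ (μ := volume.restrict Ω)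
      (ENNReal.ofReal_le_ofReal hqp) h.memLp.aestronglyMeasurable.restrict
    rw [Measure.restrict_apply_univ, ENNReal.toReal_ofReal (by linarith),
      ENNReal.toReal_ofReal (by linarith), mul_comm] at h1
    refine h1.trans (mul_le_mul' ?_ (eLpNorm_restrict_le _ _ _ _))
    rw [← ENNReal.ofReal_toReal hΩT]
    exact ENNReal.ofReal_le_ofReal (by simp [hC])
  have hAT : eLpNorm f (ENNReal.ofReal q) (volume.restrict Ω) ≠ ⊤ :=
    ne_top_of_le_ne_top (ENNReal.mul_ne_top ENNReal.ofReal_ne_top hPT) hAP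
  have hP0 : eLpNorm f (ENNReal.ofReal p) volume ≠ 0 := fun h0 => by
    rw [h0, mul_zero] at hAP
    exact hA0 (nonpos_iff_eq_zero.1 hAP)
  have hDeq := ENNReal.ofReal_toReal hDT
  have hPeq := ENNReal.ofReal_toReal hPT
  have hAeq := ENNReal.ofReal_toReal hAT
  have hD := ENNReal.toReal_pos hD0 hDT
  have hP := ENNReal.toReal_pos hP0 hPT
  have hA := ENNReal.toReal_pos hA0 hAT
  have hE' := hE h.memLp_gradient.aestronglyMeasurable hP hD hDeq.symm fun v hv => by
    rw [hPeq]
    exact h.poincare v hv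
  have hAP' := ENNReal.toReal_mono (ENNReal.mul_ne_top ENNReal.ofReal_ne_top hPT) hAP
  rw [ENNReal.toReal_mul, ENNReal.toReal_ofReal hC0.le] at hAP'
  have hreal := rpow_div_le_of_le_mul hc hC0 hA hP hD hs1 hAP'
  calc _ = normConst n Q p * ENNReal.ofReal (k *
        ((eLpNorm G (ENNReal.ofReal p) μ).toReal /
          (eLpNorm f (ENNReal.ofReal q) (volume.restrict Ω)).toReal) ^ s) := by
        rw [← hDeq, ← hAeq, ← ENNReal.ofReal_div_of_pos hA,
          ENNReal.ofReal_rpow_of_pos (by positivity),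
          mul_assoc, ← ENNReal.ofReal_mul hk0.le, hDeq, hAeq]
    _ ≤ normConst n Q p * ENNReal.ofReal (c * (eLpNorm G (ENNReal.ofReal p) μ).toReal ^ s *
          (eLpNorm f (ENNReal.ofReal p) volume).toReal ^ (1 - s) /
          (eLpNorm f (ENNReal.ofReal q) (volume.restrict Ω)).toReal) := by
        gcongr
    _ ≤ _ := by
        rw [ENNReal.ofReal_div_of_pos hA, hAeq, ← mul_div_assoc]
        gcongr

end Eigenvalue

end AffineEigenvalue

end

/-! ### Passage to the infima -/

theorem proposition1p3 (m n : ℕ) (hm : 1 ≤ m) (hn : 1 ≤ n)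
    (Q : ConvexBody (EuclideanSpace ℝ (Fin m)))
    (hQ : (0 : EuclideanSpace ℝ (Fin m)) ∈ interior (Q : Set (EuclideanSpace ℝ (Fin m))))
    (Ω : Set (EuclideanSpace ℝ (Fin n))) (hΩ : IsOpen Ω) (hΩb : Bornology.IsBounded Ω)
    (p : ℝ) (hp : 1 ≤ p) :
    (∃ d : ℝ≥0, 0 < d ∧
      AffineEigenvalue.lamAff Q p Ω ≤ AffineEigenvalue.lam p Ω ∧
      (d : ℝ≥0∞) * (AffineEigenvalue.lam p Ω) ^ (1 / ((n : ℝ) * (m : ℝ))) ≤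
        AffineEigenvalue.lamAff Q p Ω) ∧
    (∀ q : ℝ, 1 ≤ q → q ≤ p → ∃ d : ℝ≥0, 0 < d ∧
      AffineEigenvalue.lamAffQ Q p q Ω ≤ AffineEigenvalue.lamQ p q Ω ∧
      (d : ℝ≥0∞) * (AffineEigenvalue.lamQ p q Ω) ^ (1 / ((n : ℝ) * (m : ℝ))) ≤
        AffineEigenvalue.lamAffQ Q p q Ω) := by
  have hp0 : 0 < p := by linarith
  obtain ⟨T, hT, hpair⟩ := AffineEigenvalue.exists_isPoincarePair hΩ hΩb hp
  constructor
  · obtain ⟨d, hd, h⟩ :=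
      AffineEigenvalue.exists_mul_rpow_le_affineEnergy_div hn hm Q hQ hΩ hΩb hp le_rfl hT
    -- The `p`-homogeneous statement is the case `q = p` raised to the power `p`. If there are no
    -- competitors, both bounds are vacuous because every infimum is `⊤`.
    refine ⟨d ^ p, NNReal.rpow_pos hd, le_sInf ?_, le_sInf ?_⟩
    · rintro _ ⟨f, μ, G, hf, rfl⟩
      refine sInf_le_of_le ⟨f, μ, G, hf, rfl⟩ ?_
      rw [← AffineEigenvalue.eLpNorm_ofReal_rpow hp, ← AffineEigenvalue.eLpNorm_ofReal_rpow hp]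
      gcongr
      exact (hpair hf).affineEnergy_le hn hm Q hQ hp
    · rintro _ ⟨f, μ, G, hf, rfl⟩
      have hle : AffineEigenvalue.lam p Ω ≤ (eLpNorm G (ENNReal.ofReal p) μ /
          eLpNorm f (ENNReal.ofReal p) (volume.restrict Ω)) ^ p := by
        refine sInf_le ⟨f, μ, G, hf, ?_⟩
        rw [ENNReal.div_rpow_of_nonneg _ _ hp0.le, AffineEigenvalue.eLpNorm_ofReal_rpow hp,
          AffineEigenvalue.eLpNorm_ofReal_rpow hp]
      rw [← ENNReal.div_rpow_of_nonneg _ _ hp0.le]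
      refine le_trans ?_ (ENNReal.rpow_le_rpow (h (hpair hf)) hp0.le)
      rw [ENNReal.mul_rpow_of_nonneg _ _ hp0.le, ENNReal.coe_rpow_of_nonneg _ hp0.le,
        ← ENNReal.rpow_mul, mul_comm _ p, ENNReal.rpow_mul]
      gcongr
  · intro q hq hqp
    obtain ⟨d, hd, h⟩ :=
      AffineEigenvalue.exists_mul_rpow_le_affineEnergy_div hn hm Q hQ hΩ hΩb hq hqp hT
    refine ⟨d, hd, le_sInf ?_, le_sInf ?_⟩
    · rintro _ ⟨f, μ, G, hf, rfl⟩
      refine sInf_le_of_le ⟨f, μ, G, hf, rfl⟩ ?_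
      gcongr
      exact (hpair hf).affineEnergy_le hn hm Q hQ hp
    · rintro _ ⟨f, μ, G, hf, rfl⟩
      refine le_trans ?_ (h (hpair hf))
      gcongr
      exact sInf_le ⟨f, μ, G, hf, rfl⟩
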